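/- Let $n\ge 2$ and let $\theta=(\theta_1,\dots,\theta_n)\in\mathbb R^n$ be such that $1,\theta_1,\dots,\theta_n$ are linearly independent over $\mathbb Q$. Let $\lambda$ (respectively $\hat\lambda$) be the supremum in $[-\infty,+\infty]$ of the real numbers $\gamma$ such that the system $$\max_{1\le i\le n}|x_0\theta_i-x_i|\le t^{-\gamma},\qquad 0<|x_0|\le t$$ has a solution $(x_0,\dots,x_n)\in\mathbb Z^{n+1}$ for some arbitrarily large real $t$ (respectively, for every sufficiently large real $t$). Let $\omega$ (respectively $\hat\omega$) be the supremum in $[-\infty,+\infty]$ of the real numbers $\gamma$ such that the system $$|x_0+\theta_1x_1+\dots+\theta_nx_n|\le t^{-\gamma},\qquad 0<\max_{1\le i\le n}|x_i|\le t$$ has a solution $(x_0,\dots,x_n)\in\mathbb Z^{n+1}$ for some arbitrarily large real $t$ (respectively, for every sufficiently large real $t$). Suppose that $\hat\omega<\infty$, so that the quotients below are meaningful (they equal $+\infty$ if $\omega=\infty$). Then $$\hat\lambda\le\frac{\omega^{n-1}}{\hat\omega^{n}}\qquad\text{and}\qquad \lambda\le\frac{\omega^{n}}{\hat\omega^{n+1}}.$$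 -/

import Mathlib

/-- The system `max_i |x₀ θ_i - x_i| ≤ t ^ (-γ)`, `0 < |x₀| ≤ t` has an integer solution. -/
def SimSolvable {n : ℕ} (θ : Fin n → ℝ) (γ t : ℝ) : Prop :=
  ∃ (x₀ : ℤ) (x : Fin n → ℤ),
    (∀ i, |(x₀ : ℝ) * θ i - (x i : ℝ)| ≤ t ^ (-γ)) ∧ 0 < |(x₀ : ℝ)| ∧ |(x₀ : ℝ)| ≤ t

/-- The system `|x₀ + θ_1 x_1 + ... + θ_n x_n| ≤ t ^ (-γ)`, `0 < max_i |x_i| ≤ t`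
has an integer solution. -/
def LinSolvable {n : ℕ} (θ : Fin n → ℝ) (γ t : ℝ) : Prop :=
  ∃ (x₀ : ℤ) (x : Fin n → ℤ),
    |(x₀ : ℝ) + ∑ i, θ i * (x i : ℝ)| ≤ t ^ (-γ) ∧
      (∃ i, 0 < |(x i : ℝ)|) ∧ ∀ i, |(x i : ℝ)| ≤ t

/-- The regular exponent `λ(θ)` of simultaneous approximation: the supremum, in the extended
reals, of the real `γ` for which the system is solvable for arbitrarily large `t`. -/
noncomputable def regularSimExponent {n : ℕ} (θ : Fin n → ℝ) : EReal :=
  sSup ((fun γ : ℝ => (γ : EReal)) '' {γ : ℝ | ∃ᶠ t : ℝ in Filter.atTop, SimSolvable θ γ t})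

/-- The uniform exponent of simultaneous approximation: the supremum of the real `γ` for which
the system is solvable for every sufficiently large `t`. -/
noncomputable def uniformSimExponent {n : ℕ} (θ : Fin n → ℝ) : EReal :=
  sSup ((fun γ : ℝ => (γ : EReal)) '' {γ : ℝ | ∀ᶠ t : ℝ in Filter.atTop, SimSolvable θ γ t})

/-- The regular exponent `ω(θ)` of the linear form problem. -/
noncomputable def regularLinExponent {n : ℕ} (θ : Fin n → ℝ) : EReal :=
  sSup ((fun γ : ℝ => (γ : EReal)) '' {γ : ℝ | ∃ᶠ t : ℝ in Filter.atTop, LinSolvable θ γ t})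

/-- The uniform exponent of the linear form problem. -/
noncomputable def uniformLinExponent {n : ℕ} (θ : Fin n → ℝ) : EReal :=
  sSup ((fun γ : ℝ => (γ : EReal)) '' {γ : ℝ | ∀ᶠ t : ℝ in Filter.atTop, LinSolvable θ γ t})

/-! Write `L` for the form x₀ + θ₁x₁ + … + θₙxₙ, fix 0 < α < ω̂ and β > ω, and put r = β/α. Let z_T
minimise |L| among integer vectors of height at most T. Then (T+1)^(-α) ≥ |L(z_T)| ≥ T^(-β) for
large T, and everything is deduced from this.

The first ingredient is the Marnat–Moshchevitin inequality α ≤ 1 + r + … + r^(n-1)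
(`ApproxSeq.le_geom_sum`). If it failed, one could go backwards along the z_T, wedging on at each
stage the last vector outside the current span, and keep the contraction of the wedge by `L` small
throughout. Since the vectors involved always span a fixed early vector, a small contraction means
that the span can still be enlarged. This would produce n+2 independent vectors in dimension n+1.
Multiplying by r - 1 gives β - α + 1 ≤ r^n.

The second ingredient is duality. A simultaneous approximation (x₀, x) pairs with z_T to an integer
close to x₀L(z_T), so the pairing vanishes once both |x₀L(z_T)| and the error are small; vanishing
then bounds |x₀L(z_T)| by the error alone. Applied at the first T where x₀L(z_T) is small, this
gives λ ≤ (β - α + 1)/α ≤ β^n/α^(n+1) (`IsBestApprox.simExponent_le`). For λ̂, if γα > r^(n-1), each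
solution annihilates a block of the z_j so long that consecutive blocks overlap; their spans grow
until a nonzero pairing annihilates the whole space (`IsBestApprox.uniformSimExponent_le`). Finally
α → ω̂ and β → ω. -/

/-! ### Exterior algebra: norm, contraction and integrality. -/

/-- The maximum norm of the coordinates of an element of the exterior algebra of `ℝ ^ m` with
respect to the standard basis. -/
noncomputable def wedgeNorm {m : ℕ} (w : ExteriorAlgebra ℝ (Fin m → ℝ)) : ℝ :=
  ‖(Pi.basisFun ℝ (Fin m)).ExteriorAlgebra.equivFun w‖

/-- The contraction of an element of the exterior algebra by a linear form. -/
noncomputable def contract {m : ℕ} (L : (Fin m → ℝ) →ₗ[ℝ] ℝ)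
    (w : ExteriorAlgebra ℝ (Fin m → ℝ)) : ExteriorAlgebra ℝ (Fin m → ℝ) :=
  CliffordAlgebra.contractLeft (Q := (0 : QuadraticForm ℝ (Fin m → ℝ))) L w

section Wedge

variable {m : ℕ}

lemma wedgeNorm_nonneg (w : ExteriorAlgebra ℝ (Fin m → ℝ)) : 0 ≤ wedgeNorm w := norm_nonneg _

lemma wedgeNorm_pos {w : ExteriorAlgebra ℝ (Fin m → ℝ)} (hw : w ≠ 0) : 0 < wedgeNorm w := by
  unfold wedgeNorm
  rw [norm_pos_iff]
  simpa using hw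

lemma wedgeNorm_add_le (v w : ExteriorAlgebra ℝ (Fin m → ℝ)) :
    wedgeNorm (v + w) ≤ wedgeNorm v + wedgeNorm w := by
  unfold wedgeNorm
  rw [map_add]
  exact norm_add_le _ _

lemma wedgeNorm_smul (c : ℝ) (w : ExteriorAlgebra ℝ (Fin m → ℝ)) :
    wedgeNorm (c • w) = |c| * wedgeNorm w := by
  unfold wedgeNorm
  rw [map_smul, norm_smul, Real.norm_eq_abs]

lemma wedgeNorm_neg (w : ExteriorAlgebra ℝ (Fin m → ℝ)) : wedgeNorm (-w) = wedgeNorm w := by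
  unfold wedgeNorm
  rw [map_neg, norm_neg]

lemma wedgeNorm_sum_le {ι : Type*} (s : Finset ι) (f : ι → ExteriorAlgebra ℝ (Fin m → ℝ)) :
    wedgeNorm (∑ i ∈ s, f i) ≤ ∑ i ∈ s, wedgeNorm (f i) := by
  unfold wedgeNorm
  rw [map_sum]
  exact norm_sum_le _ _

lemma exists_wedgeNorm_map_le
    (f : ExteriorAlgebra ℝ (Fin m → ℝ) →ₗ[ℝ] ExteriorAlgebra ℝ (Fin m → ℝ)) :
    ∃ C : ℝ, 0 ≤ C ∧ ∀ w, wedgeNorm (f w) ≤ C * wedgeNorm w := by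
  set e := (Pi.basisFun ℝ (Fin m)).ExteriorAlgebra.equivFun with he
  let g := LinearMap.toContinuousLinearMap (e.toLinearMap ∘ₗ f ∘ₗ e.symm.toLinearMap)
  refine ⟨‖g‖, norm_nonneg _, fun w => ?_⟩
  have := g.le_opNorm (e w)
  simpa [g, wedgeNorm, ← he] using this

lemma exists_wedgeNorm_ι_mul_le (m : ℕ) :
    ∃ C : ℝ, 1 ≤ C ∧ ∀ (z : Fin m → ℝ) (w : ExteriorAlgebra ℝ (Fin m → ℝ)),
      wedgeNorm (ExteriorAlgebra.ι ℝ z * w) ≤ C * ‖z‖ * wedgeNorm w := by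
  choose C hC0 hC using fun i : Fin m => exists_wedgeNorm_map_le
    (LinearMap.mulLeft ℝ (ExteriorAlgebra.ι ℝ (Pi.basisFun ℝ (Fin m) i)))
  refine ⟨1 + ∑ i, C i, by linarith [Finset.sum_nonneg fun i (_ : i ∈ Finset.univ) => hC0 i],
    fun z w => ?_⟩
  have hz : ExteriorAlgebra.ι ℝ z * w =
      ∑ i, z i • (ExteriorAlgebra.ι ℝ (Pi.basisFun ℝ (Fin m) i) * w) := by
    conv_lhs => rw [← (Pi.basisFun ℝ (Fin m)).sum_repr z]
    simp [Finset.sum_mul]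
  rw [hz]
  refine (wedgeNorm_sum_le _ _).trans ?_
  have hw := wedgeNorm_nonneg w
  calc ∑ i, wedgeNorm (z i • (ExteriorAlgebra.ι ℝ (Pi.basisFun ℝ (Fin m) i) * w))
      ≤ ∑ i, ‖z‖ * (C i * wedgeNorm w) := by
        refine Finset.sum_le_sum fun i _ => ?_
        rw [wedgeNorm_smul]
        have h1 : |z i| ≤ ‖z‖ := norm_le_pi_norm z i
        have h2 := hC i w
        simp only [LinearMap.mulLeft_apply] at h2
        exact mul_le_mul h1 h2 (wedgeNorm_nonneg _) (norm_nonneg _)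
    _ = (∑ i, C i) * ‖z‖ * wedgeNorm w := by
        rw [← Finset.mul_sum, ← Finset.sum_mul]; ring
    _ ≤ (1 + ∑ i, C i) * ‖z‖ * wedgeNorm w := by
        have := norm_nonneg z
        gcongr
        linarith

lemma contract_ι_mul (L : (Fin m → ℝ) →ₗ[ℝ] ℝ) (z : Fin m → ℝ)
    (w : ExteriorAlgebra ℝ (Fin m → ℝ)) :
    contract L (ExteriorAlgebra.ι ℝ z * w) =
      L z • w - ExteriorAlgebra.ι ℝ z * contract L w :=
  CliffordAlgebra.contractLeft_ι_mul _ _ _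

/-- Contraction is an antiderivation, so z ∧ w = 0 gives L(z) w = z ∧ (contraction of w). Hence a
small contraction forces `L` to be small on the vectors of the subspace of `w`. -/
lemma abs_mul_wedgeNorm_le {C : ℝ}
    (hC : ∀ (z : Fin m → ℝ) (w : ExteriorAlgebra ℝ (Fin m → ℝ)),
      wedgeNorm (ExteriorAlgebra.ι ℝ z * w) ≤ C * ‖z‖ * wedgeNorm w)
    (L : (Fin m → ℝ) →ₗ[ℝ] ℝ) {z : Fin m → ℝ} {w : ExteriorAlgebra ℝ (Fin m → ℝ)}
    (hzw : ExteriorAlgebra.ι ℝ z * w = 0) :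
    |L z| * wedgeNorm w ≤ C * ‖z‖ * wedgeNorm (contract L w) := by
  have h := contract_ι_mul L z w
  rw [hzw] at h
  have h0 : contract L (0 : ExteriorAlgebra ℝ (Fin m → ℝ)) = 0 := map_zero _
  rw [h0, eq_comm, sub_eq_zero] at h
  rw [← wedgeNorm_smul, h]
  exact hC _ _

lemma wedgeNorm_contract_ι_mul_le {C : ℝ}
    (hC : ∀ (z : Fin m → ℝ) (w : ExteriorAlgebra ℝ (Fin m → ℝ)),
      wedgeNorm (ExteriorAlgebra.ι ℝ z * w) ≤ C * ‖z‖ * wedgeNorm w)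
    (L : (Fin m → ℝ) →ₗ[ℝ] ℝ) (z : Fin m → ℝ) (w : ExteriorAlgebra ℝ (Fin m → ℝ)) :
    wedgeNorm (contract L (ExteriorAlgebra.ι ℝ z * w)) ≤
      |L z| * wedgeNorm w + C * ‖z‖ * wedgeNorm (contract L w) := by
  rw [contract_ι_mul, sub_eq_add_neg]
  refine (wedgeNorm_add_le _ _).trans ?_
  rw [wedgeNorm_neg, wedgeNorm_smul]
  gcongr
  exact hC _ _

/-- The lattice spanned by the standard basis of the exterior algebra. -/
noncomputable def wedgeLattice (m : ℕ) : Submodule ℤ (ExteriorAlgebra ℝ (Fin m → ℝ)) :=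
  Submodule.span ℤ (Set.range (Pi.basisFun ℝ (Fin m)).ExteriorAlgebra)

lemma basis_singleton_eq_ι (i : Fin m) :
    (Pi.basisFun ℝ (Fin m)).ExteriorAlgebra {i} =
      ExteriorAlgebra.ι ℝ (Pi.basisFun ℝ (Fin m) i) := by
  rw [ExteriorAlgebra.basis_apply_ofCard (n := 1) _ (Finset.card_singleton i)]
  rw [ExteriorAlgebra.ιMulti_family, ExteriorAlgebra.ιMulti_succ_apply,
    ExteriorAlgebra.ιMulti_zero_apply, mul_one]
  congr 2
  simp [Set.powersetCard.ofFinEmbEquiv_symm_apply, Set.powersetCard.ofCard]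

lemma one_mem_wedgeLattice : (1 : ExteriorAlgebra ℝ (Fin m → ℝ)) ∈ wedgeLattice m := by
  refine Submodule.subset_span ⟨∅, ?_⟩
  rw [ExteriorAlgebra.basis_apply_ofCard (n := 0) _ Finset.card_empty]
  rw [ExteriorAlgebra.ιMulti_family, ExteriorAlgebra.ιMulti_zero_apply]

lemma ι_basisFun_mul_mem (i : Fin m) {w : ExteriorAlgebra ℝ (Fin m → ℝ)}
    (hw : w ∈ wedgeLattice m) :
    ExteriorAlgebra.ι ℝ (Pi.basisFun ℝ (Fin m) i) * w ∈ wedgeLattice m := by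
  induction hw using Submodule.span_induction with
  | mem x hx =>
    obtain ⟨s, rfl⟩ := hx
    rw [← basis_singleton_eq_ι]
    by_cases h : Disjoint ({i} : Finset (Fin m)) s
    · have := ExteriorAlgebra.basis_mul_of_disjoint (Pi.basisFun ℝ (Fin m))
        (Set.powersetCard.ofCard (Finset.card_singleton i))
        (Set.powersetCard.ofCard (rfl : s.card = s.card)) h
      simp only [Set.powersetCard.ofCard] at this
      rw [this]
      refine Submodule.smul_of_tower_mem _ _ (Submodule.subset_span ⟨_, rfl⟩)
    · have := ExteriorAlgebra.basis_mul_of_not_disjoint (Pi.basisFun ℝ (Fin m))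
        (Set.powersetCard.ofCard (Finset.card_singleton i))
        (Set.powersetCard.ofCard (rfl : s.card = s.card)) h
      simp only [Set.powersetCard.ofCard] at this
      rw [this]
      exact Submodule.zero_mem _
  | zero => simp
  | add x y _ _ hx hy => rw [mul_add]; exact Submodule.add_mem _ hx hy
  | smul a x _ hx => rw [mul_smul_comm]; exact Submodule.smul_mem _ _ hx

lemma ι_intCast_mul_mem (v : Fin m → ℤ) {w : ExteriorAlgebra ℝ (Fin m → ℝ)}
    (hw : w ∈ wedgeLattice m) :
    ExteriorAlgebra.ι ℝ (fun i => (v i : ℝ)) * w ∈ wedgeLattice m := by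
  have hz : ExteriorAlgebra.ι ℝ (fun i => (v i : ℝ)) * w =
      ∑ i, v i • (ExteriorAlgebra.ι ℝ (Pi.basisFun ℝ (Fin m) i) * w) := by
    conv_lhs => rw [← (Pi.basisFun ℝ (Fin m)).sum_repr (fun i => (v i : ℝ))]
    simp only [map_sum, map_zsmul, Pi.basisFun_repr, Finset.sum_mul, smul_mul_assoc,
      Int.cast_smul_eq_zsmul]
  rw [hz]
  exact Submodule.sum_mem _ fun i _ => Submodule.smul_mem _ _ (ι_basisFun_mul_mem i hw)

lemma ιMulti_intCast_mem (d : ℕ) (v : Fin d → Fin m → ℤ) :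
    ExteriorAlgebra.ιMulti ℝ d (fun k i => (v k i : ℝ)) ∈ wedgeLattice m := by
  induction d with
  | zero => rw [ExteriorAlgebra.ιMulti_zero_apply]; exact one_mem_wedgeLattice
  | succ d ih =>
    rw [ExteriorAlgebra.ιMulti_succ_apply]
    exact ι_intCast_mul_mem _ (ih _)

/-- Some coordinate is a nonzero integer. This is how integrality of the approximations enters the
exterior algebra argument. -/
lemma one_le_wedgeNorm {w : ExteriorAlgebra ℝ (Fin m → ℝ)} (hw : w ∈ wedgeLattice m)
    (hw0 : w ≠ 0) : 1 ≤ wedgeNorm w := by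
  set b := (Pi.basisFun ℝ (Fin m)).ExteriorAlgebra with hb
  have hint := (b.mem_span_iff_repr_mem ℤ w).1 hw
  have : ∃ s, b.repr w s ≠ 0 := by
    by_contra! h
    exact hw0 (b.repr.map_eq_zero_iff.1 (Finsupp.ext h))
  obtain ⟨s, hs⟩ := this
  obtain ⟨k, hk⟩ := hint s
  have hk0 : k ≠ 0 := by
    rintro rfl
    exact hs (by simpa using hk.symm)
  have h1 : ‖b.equivFun w s‖ ≤ wedgeNorm w := norm_le_pi_norm (b.equivFun w) s
  refine le_trans ?_ h1
  rw [Module.Basis.equivFun_apply, ← hk, Real.norm_eq_abs]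
  simpa using (by exact_mod_cast Int.one_le_abs hk0 : (1 : ℝ) ≤ |(k : ℝ)|)

lemma ιMulti_eq_zero_of_lt {d : ℕ} (hd : m < d) (v : Fin d → Fin m → ℝ) :
    ExteriorAlgebra.ιMulti ℝ d v = 0 := by
  refine AlternatingMap.map_linearDependent _ _ fun h => ?_
  have := h.fintype_card_le_finrank
  simp at this
  omega

end Wedge

/-- The real vector with the given integer coordinates. -/
def intVec {m : ℕ} (v : Fin m → ℤ) : Fin m → ℝ := fun i => (v i : ℝ)

/-- The vectors `z T` are integer approximations to zero of the linear form `L`: their norm is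
`O(T)` and the value of `L` lies between `T ^ (-β)` and `(T + 1) ^ (-α)`, and decreases with `T`. -/
structure ApproxSeq {m : ℕ} (L : (Fin m → ℝ) →ₗ[ℝ] ℝ) (z : ℕ → Fin m → ℤ) (α β K : ℝ)
    (T₀ : ℕ) : Prop where
  one_le : 1 ≤ T₀
  ne_zero : ∀ T, T₀ ≤ T → L (intVec (z T)) ≠ 0
  norm_le : ∀ T, T₀ ≤ T → ‖intVec (z T)‖ ≤ K * T
  antitone : ∀ S T, T₀ ≤ S → S ≤ T → |L (intVec (z T))| ≤ |L (intVec (z S))|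
  upper : ∀ T : ℕ, T₀ ≤ T → α * Real.log ((T : ℝ) + 1) ≤ -Real.log |L (intVec (z T))|
  lower : ∀ T : ℕ, T₀ ≤ T → -Real.log |L (intVec (z T))| ≤ β * Real.log T

/-! ### Stabilisation of spans of tails and of initial segments. -/

section Stabilize

variable {E : Type*} [AddCommGroup E] [Module ℝ E] [FiniteDimensional ℝ E]

lemma exists_forall_ge_mem_span_image_Ici (z : ℕ → E) :
    ∃ n₀, ∀ i j, n₀ ≤ i → n₀ ≤ j → z i ∈ Submodule.span ℝ (z '' Set.Ici j) := by
  let f : ℕ →o (Submodule ℝ E)ᵒᵈ :=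
    ⟨fun k => OrderDual.toDual (Submodule.span ℝ (z '' Set.Ici k)), fun a b hab => by
      rw [OrderDual.toDual_le_toDual]
      exact Submodule.span_mono (Set.image_mono (Set.Ici_subset_Ici.2 hab))⟩
  obtain ⟨n₀, hn₀⟩ := IsArtinian.monotone_stabilizes f
  refine ⟨n₀, fun i j hi hj => ?_⟩
  have h1 : Submodule.span ℝ (z '' Set.Ici n₀) = Submodule.span ℝ (z '' Set.Ici j) := hn₀ j hj
  rw [← h1]
  exact Submodule.subset_span ⟨i, hi, rfl⟩

lemma exists_forall_ge_mem_span_image_Icc (z : ℕ → E) (a : ℕ) :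
    ∃ N₀, ∀ N, N₀ ≤ N → Submodule.span ℝ (z '' Set.Ici a) ≤
      Submodule.span ℝ (z '' Set.Icc a N) := by
  let f : ℕ →o Submodule ℝ E :=
    ⟨fun k => Submodule.span ℝ (z '' Set.Icc a k), fun b c hbc =>
      Submodule.span_mono (Set.image_mono (Set.Icc_subset_Icc_right hbc))⟩
  obtain ⟨N₀, hN₀⟩ := monotone_stabilizes_iff_noetherian.2 inferInstance f
  refine ⟨N₀, fun N hN => Submodule.span_le.2 ?_⟩
  rintro _ ⟨j, hj, rfl⟩
  have h1 : f (max N j) = f N := (hN₀ _ (hN.trans (le_max_left _ _))).symm.trans (hN₀ N hN)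
  have h2 : z j ∈ f (max N j) := Submodule.subset_span ⟨j, ⟨hj, le_max_right _ _⟩, rfl⟩
  rw [h1] at h2
  exact h2

end Stabilize

/-! ### The Marnat–Moshchevitin inequality. -/

/-- Here `Y`, `Ye`, `Ya` stand for the logarithms of e+1, e, a; `la`, `le`, `le1` for -log|L(z)| at
a, e, e+1; `h`, `h'` for -log of the contraction norm before and after wedging with z_e; and `H` for
the log norm before. Eliminating `H` gives h' > le - sY up to constants. The remaining inequality le
- sY ≥ la - rsYa follows from monotonicity if Y ≤ rYa, and otherwise from le - la ≥ α(Y - rYa) and s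
≤ α. -/
lemma lt_of_covolume_step {α β r s K C Y Ya Ye la le le1 h h' H : ℝ} (hβ : β = r * α) (hs0 : 0 ≤ s) (hsα : s ≤ α) (hK : 0 ≤ K) (hYa : 0 ≤ Ya)
    (hYe : Ye ≤ Y) (hlae : la ≤ le) (hle : le ≤ le1) (hY : α * Y ≤ le) (hla : la ≤ β * Ya)
    (hsub : le - H - K ≤ h' ∨ h - Ye - K ≤ h') (hadd : h ≤ K + Y + le1 - H)
    (hh : le1 - (s - 1) * Y + C < h) :
    la - r * s * Ya + (C - 3 * K) < h' := by
  have key : s * Y ≤ le - la + r * s * Ya := by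
    rcases le_total Y (r * Ya) with h1 | h1
    · nlinarith
    · nlinarith
  by_contra! hcon
  rcases hsub with h1 | h1 <;> nlinarith

/-- Absolute version, from sY ≤ αY ≤ le. It is needed at the last step of the chain, where s - 1
becomes β and the relative bound compares only with l(a) - β log a ≤ 0. -/
lemma lt_of_covolume_step' {α s K C Y Ye le le1 h h' H : ℝ}
    (hsα : s ≤ α) (hK : 0 ≤ K) (hY0 : 0 ≤ Y)
    (hYe : Ye ≤ Y) (hle : le ≤ le1) (hY : α * Y ≤ le)
    (hsub : le - H - K ≤ h' ∨ h - Ye - K ≤ h') (hadd : h ≤ K + Y + le1 - H)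
    (hh : le1 - (s - 1) * Y + C < h) :
    C - 3 * K < h' := by
  by_contra! hcon
  have : s * Y ≤ α * Y := by gcongr
  rcases hsub with h1 | h1 <;> nlinarith

lemma log_add_le_log_two_add_max {x y : ℝ} (hx : 0 < x) (hy : 0 < y) :
    Real.log (x + y) ≤ Real.log 2 + Real.log x ∨ Real.log (x + y) ≤ Real.log 2 + Real.log y := by
  rcases le_total x y with h | h
  · right
    rw [← Real.log_mul (by norm_num) hy.ne']
    exact Real.log_le_log (by positivity) (by linarith)
  · left
    rw [← Real.log_mul (by norm_num) hx.ne']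
    exact Real.log_le_log (by positivity) (by linarith)

/-- Logarithmic forms of `abs_mul_wedgeNorm_le` and `wedgeNorm_contract_ι_mul_le`. The alternative
in the last clause says which of the two summands dominates. -/
lemma ApproxSeq.exists_covolume_bounds {m : ℕ} {L : (Fin m → ℝ) →ₗ[ℝ] ℝ} {z : ℕ → Fin m → ℤ}
    {α β K : ℝ} {T₀ : ℕ} (h : ApproxSeq L z α β K T₀) :
    ∃ C : ℝ, 0 ≤ C ∧
      (∀ T w, T₀ ≤ T → w ≠ 0 → ExteriorAlgebra.ι ℝ (intVec (z T)) * w = 0 →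
        0 < wedgeNorm (contract L w) ∧
        -Real.log (wedgeNorm (contract L w)) ≤ C + Real.log T + -Real.log |L (intVec (z T))| -
          Real.log (wedgeNorm w)) ∧
      (∀ T w, T₀ ≤ T → w ≠ 0 → 0 < wedgeNorm (contract L w) →
        0 < wedgeNorm (contract L (ExteriorAlgebra.ι ℝ (intVec (z T)) * w)) →
        (-Real.log |L (intVec (z T))| - Real.log (wedgeNorm w) - C ≤
          -Real.log (wedgeNorm (contract L (ExteriorAlgebra.ι ℝ (intVec (z T)) * w)))) ∨
        (-Real.log (wedgeNorm (contract L w)) - Real.log T - C ≤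
          -Real.log (wedgeNorm (contract L (ExteriorAlgebra.ι ℝ (intVec (z T)) * w))))) := by
  obtain ⟨C, hC1, hC⟩ := exists_wedgeNorm_ι_mul_le m
  have hTpos : ∀ T : ℕ, T₀ ≤ T → (0 : ℝ) < T := fun T hT => by
    exact_mod_cast lt_of_lt_of_le Nat.zero_lt_one (h.one_le.trans hT)
  set K' := max K 1 with hK'
  have hK'1 : 1 ≤ K' := le_max_right _ _
  have hnorm : ∀ T, T₀ ≤ T → ‖intVec (z T)‖ ≤ K' * T := fun T hT =>
    (h.norm_le T hT).trans (by have := hTpos T hT; gcongr; exact le_max_left _ _)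
  have hCK : 1 ≤ C * K' := one_le_mul_of_one_le_of_one_le hC1 hK'1
  have hlCK := Real.log_nonneg hCK
  have hl2 := Real.log_nonneg (show (1 : ℝ) ≤ 2 by norm_num)
  refine ⟨Real.log (C * K') + Real.log 2, by positivity, ?_, ?_⟩
  · intro T w hT hw hzw
    have hT' := hTpos T hT
    have hLz : 0 < |L (intVec (z T))| := abs_pos.2 (h.ne_zero T hT)
    have hwpos := wedgeNorm_pos hw
    have h1 : |L (intVec (z T))| * wedgeNorm w ≤ C * K' * T * wedgeNorm (contract L w) := by
      refine (abs_mul_wedgeNorm_le hC L hzw).trans ?_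
      rw [mul_assoc C K']
      have := wedgeNorm_nonneg (contract L w)
      have := hnorm T hT
      gcongr
    have hpos : 0 < wedgeNorm (contract L w) := by
      refine lt_of_le_of_ne (wedgeNorm_nonneg _) fun h0 => ?_
      rw [← h0, mul_zero] at h1
      exact absurd h1 (not_le.2 (by positivity))
    refine ⟨hpos, ?_⟩
    have h2 := Real.log_le_log (by positivity) h1
    rw [Real.log_mul hLz.ne' hwpos.ne', Real.log_mul (by positivity) hpos.ne',
      Real.log_mul (by positivity) hT'.ne'] at h2
    linarith
  · intro T w hT hw hcw hcw'
    have hT' := hTpos T hT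
    have hLz : 0 < |L (intVec (z T))| := abs_pos.2 (h.ne_zero T hT)
    have hwpos := wedgeNorm_pos hw
    have h1 : wedgeNorm (contract L (ExteriorAlgebra.ι ℝ (intVec (z T)) * w)) ≤
        |L (intVec (z T))| * wedgeNorm w + C * K' * T * wedgeNorm (contract L w) := by
      refine (wedgeNorm_contract_ι_mul_le hC L _ _).trans ?_
      rw [mul_assoc C K']
      have := hnorm T hT
      gcongr
    have h2 := Real.log_le_log hcw' h1
    have h3 := Real.log_mul hLz.ne' hwpos.ne'
    have h4 : Real.log (C * K' * T * wedgeNorm (contract L w)) =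
        Real.log (C * K') + Real.log T + Real.log (wedgeNorm (contract L w)) := by
      rw [Real.log_mul (by positivity) hcw.ne', Real.log_mul (by positivity) hT'.ne']
    rcases log_add_le_log_two_add_max (x := |L (intVec (z T))| * wedgeNorm w)
      (y := C * K' * T * wedgeNorm (contract L w)) (by positivity) (by positivity) with h5 | h5
    · left; linarith
    · right; linarith

lemma exists_greatest_lt_not {P : ℕ → Prop} {a b : ℕ} (h : ∃ j, a ≤ j ∧ j < b ∧ ¬ P j) :
    ∃ e, a ≤ e ∧ e < b ∧ ¬ P e ∧ ∀ j, e < j → j < b → P j := by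
  classical
  obtain ⟨j, haj, hjb, hj⟩ := h
  set S := (Finset.Ico a b).filter (fun j => ¬ P j) with hS
  have hne : S.Nonempty := ⟨j, by simp [hS, haj, hjb, hj]⟩
  have he := Finset.mem_filter.1 (S.max'_mem hne)
  rw [Finset.mem_Ico] at he
  refine ⟨S.max' hne, he.1.1, he.1.2, he.2, fun k hk hkb => ?_⟩
  by_contra hcon
  have := S.le_max' k (by rw [hS, Finset.mem_filter, Finset.mem_Ico]; exact ⟨⟨by omega, hkb⟩, hcon⟩)
  omega

lemma contract_one {m : ℕ} (L : (Fin m → ℝ) →ₗ[ℝ] ℝ) :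
    contract L (1 : ExteriorAlgebra ℝ (Fin m → ℝ)) = 0 :=
  CliffordAlgebra.contractLeft_one (Q := (0 : QuadraticForm ℝ (Fin m → ℝ))) L

/-- The Marnat–Moshchevitin inequality, in terms of a sequence of approximations. -/
theorem ApproxSeq.le_geom_sum {n : ℕ} (hn : 1 ≤ n) {L : (Fin (n + 1) → ℝ) →ₗ[ℝ] ℝ}
    {z : ℕ → Fin (n + 1) → ℤ} {α β K : ℝ} {T₀ : ℕ} (h : ApproxSeq L z α β K T₀)
    (hα : 0 < α) (hαβ : α ≤ β) :
    α ≤ ∑ i ∈ Finset.range n, (β / α) ^ i := by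
  by_contra! hcon
  set r := β / α with hr
  have hr1 : 1 ≤ r := (one_le_div hα).2 hαβ
  have hr0 : 0 ≤ r := zero_le_one.trans hr1
  have hβ : β = r * α := by rw [hr]; field_simp
  -- The slack τ is normalised so that the weights `s d` below, with s(d+1) = 1 + r s(d), reach
  -- exactly α at d = n - 1.
  obtain ⟨τ, hτ0, hτ⟩ : ∃ τ : ℝ, 0 < τ ∧ ∑ i ∈ Finset.range n, r ^ i + τ * r ^ (n - 1) = α := by
    refine ⟨(α - ∑ i ∈ Finset.range n, r ^ i) / r ^ (n - 1), by
      apply div_pos (by linarith) (by positivity), ?_⟩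
    have : r ^ (n - 1) ≠ 0 := by positivity
    field_simp
    ring
  let s : ℕ → ℝ := fun d => ∑ i ∈ Finset.range (d + 1), r ^ i + τ * r ^ d
  have hs0 : ∀ d, 0 ≤ s d := fun d =>
    add_nonneg (Finset.sum_nonneg fun i _ => pow_nonneg hr0 i)
      (mul_nonneg hτ0.le (pow_nonneg hr0 d))
  have hs_succ : ∀ d, s (d + 1) = 1 + r * s d := fun d => by
    simp only [s]
    rw [Finset.sum_range_succ', mul_add, Finset.mul_sum]
    simp only [pow_succ, pow_zero]
    have : ∀ x ∈ Finset.range (d + 1), r ^ x * r = r * r ^ x := fun x _ => mul_comm _ _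
    rw [Finset.sum_congr rfl this]
    ring
  have hsα : ∀ d, d < n → s d ≤ α := fun d hd => by
    rw [← hτ]
    have h1 : r ^ d ≤ r ^ (n - 1) := pow_le_pow_right₀ hr1 (by omega)
    have h2 : ∑ i ∈ Finset.range (d + 1), r ^ i ≤ ∑ i ∈ Finset.range n, r ^ i :=
      Finset.sum_le_sum_of_subset_of_nonneg (Finset.range_subset_range.2 hd)
        fun i _ _ => by positivity
    simp only [s]
    gcongr
  obtain ⟨C, hC0, hF1, hF2⟩ := h.exists_covolume_bounds
  set l : ℕ → ℝ := fun T => -Real.log |L (intVec (z T))| with hl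
  have hlmono : ∀ S T, T₀ ≤ S → S ≤ T → l S ≤ l T := fun S T hS hST => by
    have := Real.log_le_log (abs_pos.2 (h.ne_zero T (hS.trans hST))) (h.antitone S T hS hST)
    simp only [hl]
    linarith
  obtain ⟨n₀, hn₀⟩ := exists_forall_ge_mem_span_image_Ici fun T => intVec (z T)
  set i₀ := max n₀ T₀ with hi₀
  set Cs := C + Real.log i₀ + l i₀ with hCs
  set c₁ := Real.log (wedgeNorm (1 : ExteriorAlgebra ℝ (Fin (n + 1) → ℝ))) with hc₁
  have hlog : Filter.Tendsto (fun k : ℕ => Real.log k) Filter.atTop Filter.atTop :=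
    Real.tendsto_log_atTop.comp tendsto_natCast_atTop_atTop
  -- `Cs` depends only on the fixed index `i₀`, so `i₁` can be taken large enough for τ log i₁ to
  -- pay for the loss 3C in each of the n steps.
  obtain ⟨i₁, hi₁, hi₁τ, hi₁α⟩ : ∃ i₁, i₀ ≤ i₁ ∧ Cs + 3 * C * n + c₁ < τ * Real.log i₁ ∧
      Cs + c₁ < α * Real.log i₁ := by
    have e1 := (hlog.const_mul_atTop hτ0).eventually_gt_atTop (Cs + 3 * C * n + c₁)
    have e2 := (hlog.const_mul_atTop hα).eventually_gt_atTop (Cs + c₁)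
    obtain ⟨i, hi⟩ := (e1.and (e2.and (Filter.eventually_ge_atTop i₀))).exists
    exact ⟨i, hi.2.2, hi.1, hi.2.1⟩
  have hT₀i₁ : T₀ ≤ i₁ := (le_max_right _ _).trans hi₁
  have hlogmono : ∀ a b : ℕ, T₀ ≤ a → a ≤ b → Real.log a ≤ Real.log b := fun a b ha hab =>
    Real.log_le_log (by exact_mod_cast lt_of_lt_of_le Nat.zero_lt_one (h.one_le.trans ha))
      (by exact_mod_cast hab)
  have hlog0 : ∀ a : ℕ, 0 ≤ Real.log a := Real.log_natCast_nonneg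
  have hup : ∀ T, T₀ ≤ T → α * Real.log (T + 1 : ℕ) ≤ l T := fun T hT => by
    have := h.upper T hT
    push_cast
    exact this
  obtain ⟨N₀, hN₀⟩ := exists_forall_ge_mem_span_image_Icc (fun T => intVec (z T)) i₁
  set N := max N₀ i₁ with hN
  have hi₁N : i₁ ≤ N := le_max_right _ _
  have hspan : intVec (z i₀) ∈ Submodule.span ℝ ((fun T => intVec (z T)) '' Set.Icc i₁ N) :=
    hN₀ N (le_max_left _ _) (hn₀ i₀ i₁ (le_max_left _ _) ((le_max_left _ _).trans hi₁))
  -- a wedge of large height does not annihilate all the vectors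
  have hstuck : ∀ w ∈ wedgeLattice (n + 1), w ≠ 0 →
      Cs < -Real.log (wedgeNorm (contract L w)) →
      ∃ j, i₁ ≤ j ∧ j ≤ N ∧ ¬ ExteriorAlgebra.ι ℝ (intVec (z j)) * w = 0 := by
    intro w hw hw0 hlt
    by_contra! hall
    have hker : Submodule.span ℝ ((fun T => intVec (z T)) '' Set.Icc i₁ N) ≤
        LinearMap.ker (LinearMap.mulRight ℝ w ∘ₗ ExteriorAlgebra.ι ℝ) := by
      refine Submodule.span_le.2 ?_
      rintro _ ⟨j, hj, rfl⟩
      simpa using hall j hj.1 hj.2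
    have hk : ExteriorAlgebra.ι ℝ (intVec (z i₀)) * w = 0 := by
      simpa using hker hspan
    have h1 := (hF1 i₀ w (le_max_right _ _) hw0 hk).2
    have h2 := Real.log_nonneg (one_le_wedgeNorm hw hw0)
    simp only [hCs, hl] at hlt
    linarith
  -- Invariant: the wedge contains every z_j with b ≤ j ≤ N, its contraction is small relative to
  -- each z_a with i₁ ≤ a ≤ b, and it is small enough in absolute terms for `hstuck`.
  have hchain : ∀ d, d ≤ n → ∃ (v : Fin (d + 1) → Fin (n + 1) → ℤ) (b : ℕ), i₁ ≤ b ∧ b ≤ N ∧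
      ExteriorAlgebra.ιMulti ℝ (d + 1) (fun k => intVec (v k)) ≠ 0 ∧
      (∀ j, b ≤ j → j ≤ N → ExteriorAlgebra.ι ℝ (intVec (z j)) *
        ExteriorAlgebra.ιMulti ℝ (d + 1) (fun k => intVec (v k)) = 0) ∧
      (∀ a, i₁ ≤ a → a ≤ b → l a - (s d - 1) * Real.log a + (Cs + 3 * C * (n - d)) <
        -Real.log (wedgeNorm (contract L
          (ExteriorAlgebra.ιMulti ℝ (d + 1) (fun k => intVec (v k)))))) ∧
      Cs < -Real.log (wedgeNorm (contract L
          (ExteriorAlgebra.ιMulti ℝ (d + 1) (fun k => intVec (v k))))) := by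
    intro d
    induction d with
    | zero =>
      intro _
      have hw : ExteriorAlgebra.ιMulti ℝ 1 (fun _ : Fin 1 => intVec (z N)) =
          ExteriorAlgebra.ι ℝ (intVec (z N)) := by
        rw [ExteriorAlgebra.ιMulti_succ_apply, ExteriorAlgebra.ιMulti_zero_apply, mul_one]
      have hT₀N := hT₀i₁.trans hi₁N
      have hne := h.ne_zero N hT₀N
      have h1pos : 0 < wedgeNorm (1 : ExteriorAlgebra ℝ (Fin (n + 1) → ℝ)) :=
        wedgeNorm_pos one_ne_zero
      have hh : -Real.log (wedgeNorm (contract L (ExteriorAlgebra.ι ℝ (intVec (z N))))) =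
          l N - c₁ := by
        have := contract_ι_mul L (intVec (z N)) 1
        rw [mul_one, contract_one, mul_zero, sub_zero] at this
        rw [this, wedgeNorm_smul, Real.log_mul (abs_ne_zero.2 hne) h1pos.ne']
        simp only [hl, hc₁]
        ring
      refine ⟨fun _ => z N, N, hi₁N, le_rfl, ?_, ?_, ?_, ?_⟩
      · rw [hw, Ne, ExteriorAlgebra.ι_eq_zero_iff]
        intro h0
        rw [h0, map_zero] at hne
        exact hne rfl
      · intro j hj hjN
        obtain rfl : j = N := le_antisymm hjN hj
        rw [hw]
        exact ExteriorAlgebra.ι_sq_zero _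
      · intro a ha haN
        rw [hw, hh]
        have h1 := hlmono a N (hT₀i₁.trans ha) haN
        have h2 := hlogmono i₁ a hT₀i₁ ha
        have h3 : s 0 - 1 = τ := by simp [s]
        rw [h3]
        have h4 : τ * Real.log i₁ ≤ τ * Real.log a := by gcongr
        push_cast
        linarith
      · rw [hw, hh]
        have h1 := hlmono i₁ N hT₀i₁ hi₁N
        have h2 := hup i₁ hT₀i₁
        have h3 : α * Real.log i₁ ≤ α * Real.log (i₁ + 1 : ℕ) := by
          have := hlogmono i₁ (i₁ + 1) hT₀i₁ (by omega)
          gcongr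
        linarith
    | succ d ih =>
      intro hd
      obtain ⟨v, b, hb, hbN, hw0, hkill, hlow, hbig⟩ := ih (by omega)
      set w := ExteriorAlgebra.ιMulti ℝ (d + 1) (fun k => intVec (v k)) with hw
      have hwmem : w ∈ wedgeLattice (n + 1) := ιMulti_intCast_mem _ v
      obtain ⟨j, hj, hjN, hjw⟩ := hstuck w hwmem hw0 hbig
      have hjb : j < b := by
        by_contra! hbj
        exact hjw (hkill j hbj hjN)
      obtain ⟨e, he, heb, hew, hmax⟩ := exists_greatest_lt_not
        (P := fun j => ExteriorAlgebra.ι ℝ (intVec (z j)) * w = 0) ⟨j, hj, hjb, hjw⟩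
      have hT₀e := hT₀i₁.trans he
      have hkill' : ∀ j, e < j → j ≤ N → ExteriorAlgebra.ι ℝ (intVec (z j)) * w = 0 := by
        intro j hj hjN
        rcases lt_or_ge j b with hjb | hjb
        · exact hmax j hj hjb
        · exact hkill j hjb hjN
      set w' := ExteriorAlgebra.ι ℝ (intVec (z e)) * w with hw'
      have hw'eq : ExteriorAlgebra.ιMulti ℝ (d + 1 + 1)
          (fun k => intVec ((Fin.cons (z e) v : Fin (d + 1 + 1) → Fin (n + 1) → ℤ) k)) = w' := by
        rw [ExteriorAlgebra.ιMulti_succ_apply]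
        rfl
      have hkille : ∀ j, e ≤ j → j ≤ N → ExteriorAlgebra.ι ℝ (intVec (z j)) * w' = 0 := by
        intro j hj hjN
        rcases hj.eq_or_lt with rfl | hj
        · rw [hw', ← mul_assoc, ExteriorAlgebra.ι_sq_zero, zero_mul]
        · have h1 := ExteriorAlgebra.ι_add_mul_swap (R := ℝ) (intVec (z j)) (intVec (z e))
          rw [hw', ← mul_assoc, eq_neg_of_add_eq_zero_left h1, neg_mul, mul_assoc,
            hkill' j hj hjN, mul_zero, neg_zero]
      -- By maximality of `e`, z_{e+1} lies in the subspace of `w`; this bounds the norm of `w` from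
      -- above.
      have hadd := hF1 (e + 1) w (by omega) hw0 (hkill' (e + 1) (by omega) (by omega))
      have hpos' := (hF1 e w' hT₀e hew (hkille e le_rfl (by omega))).1
      have hsub := hF2 e w hT₀e hw0 hadd.1 hpos'
      have hlow1 := hlow (e + 1) (by omega) (by omega)
      have hYe := hlogmono e (e + 1) hT₀e (by omega)
      have hle := hlmono e (e + 1) hT₀e (by omega)
      refine ⟨Fin.cons (z e) v, e, he, by omega, ?_, ?_, ?_, ?_⟩
      · rw [hw'eq]; exact hew
      · rw [hw'eq]; exact hkille
      · intro a ha hae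
        rw [hw'eq]
        have := lt_of_covolume_step (Ya := Real.log a) (la := l a) hβ (hs0 d)
          (hsα d (by omega)) hC0 (hlog0 a) hYe (hlmono a e (hT₀i₁.trans ha) hae) hle (hup e hT₀e)
          (h.lower a (hT₀i₁.trans ha)) hsub hadd.2 hlow1
        rw [hs_succ]
        push_cast
        linarith
      · rw [hw'eq]
        have := lt_of_covolume_step' (hsα d (by omega)) hC0 (hlog0 _) hYe hle (hup e hT₀e)
          hsub hadd.2 hlow1
        have hdn : (d : ℝ) + 1 ≤ n := by exact_mod_cast hd
        nlinarith
  -- The wedge now has top degree n + 1, so wedging with any further vector gives zero, against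
  -- `hstuck`.
  obtain ⟨v, b, hb, hbN, hw0, hkill, -, hbig⟩ := hchain n le_rfl
  obtain ⟨j, hj, hjN, hjw⟩ := hstuck _ (ιMulti_intCast_mem _ v) hw0 hbig
  refine hjw ?_
  have := ιMulti_eq_zero_of_lt (m := n + 1) (d := n + 1 + 1) (by omega)
    (fun k => intVec ((Fin.cons (z j) v : Fin (n + 1 + 1) → Fin (n + 1) → ℤ) k))
  rw [ExteriorAlgebra.ιMulti_succ_apply] at this
  exact this

theorem ApproxSeq.sub_add_one_le_pow {n : ℕ} (hn : 1 ≤ n) {L : (Fin (n + 1) → ℝ) →ₗ[ℝ] ℝ}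
    {z : ℕ → Fin (n + 1) → ℤ} {α β K : ℝ} {T₀ : ℕ} (h : ApproxSeq L z α β K T₀)
    (hα : 0 < α) (hαβ : α ≤ β) :
    β - α + 1 ≤ (β / α) ^ n := by
  have h1 := h.le_geom_sum hn hα hαβ
  have h2 := mul_geom_sum (β / α) n
  have h3 : 0 ≤ β / α - 1 := sub_nonneg.2 ((one_le_div hα).2 hαβ)
  have h4 : (β / α - 1) * α = β - α := by field_simp
  nlinarith

/-! ### Pairing of simultaneous approximations with integer vectors. -/

/-- The linear form `x₀ + θ₁ x₁ + ... + θₙ xₙ`. -/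
noncomputable def linForm {n : ℕ} (θ : Fin n → ℝ) : (Fin (n + 1) → ℝ) →ₗ[ℝ] ℝ :=
  LinearMap.proj 0 + ∑ i, θ i • LinearMap.proj (Fin.succ i)

lemma linForm_apply {n : ℕ} (θ : Fin n → ℝ) (v : Fin (n + 1) → ℝ) :
    linForm θ v = v 0 + ∑ i, θ i * v (Fin.succ i) := by
  simp [linForm]

/-- The linear form on real vectors with the given integer coefficients. -/
noncomputable def pairing {n : ℕ} (x₀ : ℤ) (x : Fin n → ℤ) : (Fin (n + 1) → ℝ) →ₗ[ℝ] ℝ :=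
  (x₀ : ℝ) • LinearMap.proj 0 + ∑ i, (x i : ℝ) • LinearMap.proj (Fin.succ i)

lemma pairing_apply {n : ℕ} (x₀ : ℤ) (x : Fin n → ℤ) (v : Fin (n + 1) → ℝ) :
    pairing x₀ x v = x₀ * v 0 + ∑ i, (x i : ℝ) * v (Fin.succ i) := by
  simp [pairing]

lemma pairing_intVec {n : ℕ} (x₀ : ℤ) (x : Fin n → ℤ) (v : Fin (n + 1) → ℤ) :
    pairing x₀ x (intVec v) = ((x₀ * v 0 + ∑ i, x i * v (Fin.succ i) : ℤ) : ℝ) := by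
  simp [pairing_apply, intVec]

lemma one_le_abs_pairing {n : ℕ} {x₀ : ℤ} {x : Fin n → ℤ} {v : Fin (n + 1) → ℤ}
    (h : pairing x₀ x (intVec v) ≠ 0) : 1 ≤ |pairing x₀ x (intVec v)| := by
  rw [pairing_intVec] at h ⊢
  exact_mod_cast Int.one_le_abs (by exact_mod_cast h)

/-- Replacing each x_i by x₀θ_i turns the pairing into x₀L(v). -/
lemma abs_pairing_sub_le {n : ℕ} {θ : Fin n → ℝ} {x₀ : ℤ} {x : Fin n → ℤ}
    {v : Fin (n + 1) → ℤ} {δ T : ℝ} (hδ : ∀ i, |(x₀ : ℝ) * θ i - x i| ≤ δ)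
    (hT0 : 0 ≤ T) (hT : ∀ i : Fin n, |(v i.succ : ℝ)| ≤ T) :
    |pairing x₀ x (intVec v) - x₀ * linForm θ (intVec v)| ≤ n * T * δ := by
  have h1 : pairing x₀ x (intVec v) - x₀ * linForm θ (intVec v) =
      -∑ i, (v i.succ : ℝ) * ((x₀ : ℝ) * θ i - x i) := by
    rw [pairing_apply, linForm_apply, mul_add, Finset.mul_sum, add_sub_add_left_eq_sub,
      ← Finset.sum_sub_distrib, ← Finset.sum_neg_distrib]
    refine Finset.sum_congr rfl fun i _ => ?_
    simp only [intVec]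
    ring
  rw [h1, abs_neg]
  refine (Finset.abs_sum_le_sum_abs _ _).trans ?_
  calc ∑ i, |(v i.succ : ℝ) * ((x₀ : ℝ) * θ i - x i)| ≤ ∑ _i : Fin n, T * δ := by
        refine Finset.sum_le_sum fun i _ => ?_
        rw [abs_mul]
        exact mul_le_mul (hT i) (hδ i) (abs_nonneg _) hT0
    _ = n * T * δ := by simp; ring

lemma abs_mul_linForm_le_of_pairing_eq_zero {n : ℕ} {θ : Fin n → ℝ} {x₀ : ℤ} {x : Fin n → ℤ}
    {v : Fin (n + 1) → ℤ} {δ T : ℝ} (hδ : ∀ i, |(x₀ : ℝ) * θ i - x i| ≤ δ)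
    (hT0 : 0 ≤ T) (hT : ∀ i : Fin n, |(v i.succ : ℝ)| ≤ T)
    (h : pairing x₀ x (intVec v) = 0) :
    |(x₀ : ℝ)| * |linForm θ (intVec v)| ≤ n * T * δ := by
  have := abs_pairing_sub_le hδ hT0 hT
  rwa [h, zero_sub, abs_neg, abs_mul] at this

lemma pairing_eq_zero {n : ℕ} {θ : Fin n → ℝ} {x₀ : ℤ} {x : Fin n → ℤ}
    {v : Fin (n + 1) → ℤ} {δ T : ℝ} (hδ : ∀ i, |(x₀ : ℝ) * θ i - x i| ≤ δ)
    (hT0 : 0 ≤ T) (hT : ∀ i : Fin n, |(v i.succ : ℝ)| ≤ T)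
    (h : |(x₀ : ℝ)| * |linForm θ (intVec v)| + n * T * δ < 1) :
    pairing x₀ x (intVec v) = 0 := by
  by_contra h0
  have h1 := one_le_abs_pairing h0
  have h2 := abs_pairing_sub_le (θ := θ) hδ hT0 hT
  have h3 := abs_sub_abs_le_abs_sub (pairing x₀ x (intVec v)) (x₀ * linForm θ (intVec v))
  rw [abs_mul] at h3
  linarith

lemma one_le_of_pairing_ne_zero {n : ℕ} {θ : Fin n → ℝ} {x₀ : ℤ} {x : Fin n → ℤ}
    {v : Fin (n + 1) → ℤ} {δ T : ℝ} (hδ : ∀ i, |(x₀ : ℝ) * θ i - x i| ≤ δ)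
    (hT0 : 0 ≤ T) (hT : ∀ i : Fin n, |(v i.succ : ℝ)| ≤ T)
    (h : pairing x₀ x (intVec v) ≠ 0) :
    1 ≤ |(x₀ : ℝ)| * |linForm θ (intVec v)| + n * T * δ := by
  by_contra! h1
  exact h (pairing_eq_zero hδ hT0 hT h1)

/-- If the pairing vanished, |L(v)| ≤ |x₀L(v)| would be O(t^(-γ)), impossible for fixed v. This
keeps the indices found later beyond any prescribed bound. -/
lemma eventually_pairing_ne_zero {n : ℕ} {θ : Fin n → ℝ} {v : Fin (n + 1) → ℤ}
    (hv : linForm θ (intVec v) ≠ 0) {γ : ℝ} (hγ : 0 < γ) :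
    ∀ᶠ t : ℝ in Filter.atTop, ∀ (x₀ : ℤ) (x : Fin n → ℤ), 0 < |(x₀ : ℝ)| →
      (∀ i, |(x₀ : ℝ) * θ i - x i| ≤ t ^ (-γ)) → pairing x₀ x (intVec v) ≠ 0 := by
  set T : ℝ := ∑ i : Fin n, |(v i.succ : ℝ)| with hT
  have hT0 : 0 ≤ T := Finset.sum_nonneg fun i _ => abs_nonneg _
  have hTi : ∀ i : Fin n, |(v i.succ : ℝ)| ≤ T := fun i =>
    Finset.single_le_sum (f := fun i : Fin n => |(v i.succ : ℝ)|)
      (fun i _ => abs_nonneg _) (Finset.mem_univ i)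
  have hlim : Filter.Tendsto (fun t : ℝ => n * T * t ^ (-γ)) Filter.atTop (nhds (n * T * 0)) :=
    (tendsto_rpow_neg_atTop hγ).const_mul _
  rw [mul_zero] at hlim
  filter_upwards [hlim.eventually_lt_const (abs_pos.2 hv)] with t ht x₀ x hx₀ hx h0
  have h1 := abs_mul_linForm_le_of_pairing_eq_zero hx hT0 hTi h0
  have h2 : (1 : ℝ) ≤ |(x₀ : ℝ)| := by
    have : x₀ ≠ 0 := by
      rintro rfl
      simp at hx₀
    exact_mod_cast Int.one_le_abs this
  nlinarith [abs_nonneg (linForm θ (intVec v))]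

lemma linForm_intVec_ne_zero {n : ℕ} {θ : Fin n → ℝ}
    (hθ : LinearIndependent ℚ (Fin.cons 1 θ : Fin (n + 1) → ℝ)) {v : Fin (n + 1) → ℤ}
    (hv : v ≠ 0) : linForm θ (intVec v) ≠ 0 := by
  intro h0
  rw [Fintype.linearIndependent_iff] at hθ
  refine hv (funext fun i => ?_)
  have := hθ (fun i => (v i : ℚ)) (by
    rw [linForm_apply] at h0
    rw [Fin.sum_univ_succ, ← h0]
    simp [intVec, Rat.smul_def, mul_comm]) i
  exact_mod_cast this

/-! ### Best approximations and the exponents of the linear form. -/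

/-- For every `T ≥ 1`, the vector `z T` minimizes the absolute value of the linear form among the
integer vectors whose coordinates of positive index are at most `T` and not all zero. -/
def IsBestApprox {n : ℕ} (θ : Fin n → ℝ) (z : ℕ → Fin (n + 1) → ℤ) : Prop :=
  ∀ T : ℕ, 1 ≤ T → (∃ i : Fin n, z T i.succ ≠ 0) ∧ (∀ i : Fin n, |(z T i.succ : ℝ)| ≤ T) ∧
    ∀ v : Fin (n + 1) → ℤ, (∃ i : Fin n, v i.succ ≠ 0) → (∀ i : Fin n, |(v i.succ : ℝ)| ≤ T) →
      |linForm θ (intVec (z T))| ≤ |linForm θ (intVec v)|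

lemma abs_zero_coord_le {n : ℕ} (θ : Fin n → ℝ) {v : Fin (n + 1) → ℤ} {T : ℝ}
    (hv : ∀ i : Fin n, |(v i.succ : ℝ)| ≤ T) :
    |(v 0 : ℝ)| ≤ |linForm θ (intVec v)| + (∑ i, |θ i|) * T := by
  have h1 : (v 0 : ℝ) = linForm θ (intVec v) - ∑ i, θ i * v i.succ := by
    rw [linForm_apply]
    simp [intVec]
  rw [h1]
  refine (abs_sub _ _).trans ?_
  gcongr
  refine (Finset.abs_sum_le_sum_abs _ _).trans ?_
  rw [Finset.sum_mul]
  refine Finset.sum_le_sum fun i _ => ?_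
  rw [abs_mul]
  exact mul_le_mul_of_nonneg_left (hv i) (abs_nonneg _)

/-- Only finitely many admissible vectors do at least as well as the all-ones vector, since `L` and
the other coordinates control the coordinate of index 0. -/
lemma exists_isBestApprox {n : ℕ} (hn : 1 ≤ n) (θ : Fin n → ℝ) : ∃ z, IsBestApprox θ z := by
  have key : ∀ T : ℕ, 1 ≤ T → ∃ u : Fin (n + 1) → ℤ, (∃ i : Fin n, u i.succ ≠ 0) ∧
      (∀ i : Fin n, |(u i.succ : ℝ)| ≤ T) ∧
      ∀ v : Fin (n + 1) → ℤ, (∃ i : Fin n, v i.succ ≠ 0) → (∀ i : Fin n, |(v i.succ : ℝ)| ≤ T) →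
      |linForm θ (intVec u)| ≤ |linForm θ (intVec v)| := by
    intro T hT
    have hT1 : (1 : ℝ) ≤ T := by exact_mod_cast hT
    let u₁ : Fin (n + 1) → ℤ := fun _ => 1
    set B := |linForm θ (intVec u₁)| with hB
    set S : Set (Fin (n + 1) → ℤ) := {v | (∃ i : Fin n, v i.succ ≠ 0) ∧
      (∀ i : Fin n, |(v i.succ : ℝ)| ≤ T) ∧ |linForm θ (intVec v)| ≤ B} with hS
    have hu₁ : u₁ ∈ S := ⟨⟨⟨0, hn⟩, by simp [u₁]⟩, fun i => by simpa [u₁] using hT1, le_rfl⟩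
    obtain ⟨M, hM⟩ := exists_nat_ge (B + (∑ i, |θ i|) * T + T)
    have hsum : 0 ≤ (∑ i, |θ i|) * T := by positivity
    have hfin : S.Finite := by
      refine (Set.finite_Icc (fun _ : Fin (n + 1) => -(M : ℤ)) (fun _ => (M : ℤ))).subset ?_
      rintro v ⟨-, hv, hvB⟩
      have hvM : ∀ j, |v j| ≤ (M : ℤ) := by
        intro j
        have : |(v j : ℝ)| ≤ M := by
          refine Fin.cases ?_ (fun i => ?_) j
          · have := abs_zero_coord_le θ hv
            linarith
          · have := hv i
            have : 0 ≤ B := abs_nonneg _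
            linarith
        exact_mod_cast this
      exact ⟨fun j => (abs_le.1 (hvM j)).1, fun j => (abs_le.1 (hvM j)).2⟩
    obtain ⟨u, hu, hmin⟩ := Set.exists_min_image S (fun v => |linForm θ (intVec v)|) hfin ⟨u₁, hu₁⟩
    refine ⟨u, hu.1, hu.2.1, fun v hv hvT => ?_⟩
    rcases le_total |linForm θ (intVec v)| B with h | h
    · exact hmin v ⟨hv, hvT, h⟩
    · exact (hmin u₁ hu₁).trans h
  choose! z hz using key
  exact ⟨z, hz⟩

lemma LinSolvable.mono_exponent {n : ℕ} {θ : Fin n → ℝ} {γ γ' t : ℝ} (ht : 1 ≤ t)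
    (hγ : γ' ≤ γ) (h : LinSolvable θ γ t) : LinSolvable θ γ' t := by
  obtain ⟨x₀, x, hx, h0⟩ := h
  exact ⟨x₀, x, hx.trans (Real.rpow_le_rpow_of_exponent_le ht (by linarith)), h0⟩

lemma eventually_linSolvable {n : ℕ} {θ : Fin n → ℝ} {α : ℝ}
    (h : (α : EReal) < uniformLinExponent θ) : ∀ᶠ t : ℝ in Filter.atTop, LinSolvable θ α t := by
  obtain ⟨_, ⟨γ, hγ, rfl⟩, hlt⟩ := lt_sSup_iff.1 h
  filter_upwards [hγ, Filter.eventually_ge_atTop 1] with t ht ht1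
  exact ht.mono_exponent ht1 (EReal.coe_le_coe_iff.1 hlt.le)

lemma eventually_not_linSolvable {n : ℕ} {θ : Fin n → ℝ} {β : ℝ}
    (h : regularLinExponent θ < (β : EReal)) :
    ∀ᶠ t : ℝ in Filter.atTop, ¬ LinSolvable θ β t := by
  by_contra hcon
  exact absurd (le_sSup ⟨β, hcon, rfl⟩ : (β : EReal) ≤ regularLinExponent θ) (not_le.2 h)

lemma uniformLinExponent_le_regularLinExponent {n : ℕ} (θ : Fin n → ℝ) :
    uniformLinExponent θ ≤ regularLinExponent θ :=
  sSup_le_sSup (Set.image_mono fun _ h => Filter.Eventually.frequently h)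

/-- Dirichlet's theorem for a single θ_i; only the positivity of ω̂ matters below. -/
lemma one_le_uniformLinExponent {n : ℕ} (hn : 1 ≤ n) (θ : Fin n → ℝ) :
    1 ≤ uniformLinExponent θ := by
  refine le_sSup ⟨1, ?_, by simp⟩
  filter_upwards [Filter.eventually_ge_atTop 1] with t ht
  have hfl : 0 < ⌊t⌋₊ := Nat.floor_pos.2 ht
  let i₀ : Fin n := ⟨0, hn⟩
  obtain ⟨j, k, hk0, hk, hjk⟩ := Real.exists_int_int_abs_mul_sub_le (θ i₀) hfl
  have hkt : (k : ℝ) ≤ t := by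
    have h1 : (k : ℝ) ≤ (⌊t⌋₊ : ℝ) := by exact_mod_cast hk
    exact h1.trans (Nat.floor_le (by linarith))
  have hk0' : (0 : ℝ) < k := by exact_mod_cast hk0
  refine ⟨-j, fun i => if i = i₀ then k else 0, ?_, ⟨i₀, by simpa using hk0.ne'⟩, fun i => ?_⟩
  · have : ((-j : ℤ) : ℝ) + ∑ i, θ i * ((if i = i₀ then k else 0 : ℤ) : ℝ) = k * θ i₀ - j := by
      simp [Finset.sum_ite_eq']
      ring
    rw [this, Real.rpow_neg_one]
    refine hjk.trans ?_
    rw [inv_eq_one_div]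
    exact one_div_le_one_div_of_le (by linarith) (Nat.lt_floor_add_one t).le
  · by_cases h : i = i₀
    · simpa [h, abs_of_pos hk0'] using hkt
    · simp [h]
      linarith

lemma IsBestApprox.ne_zero {n : ℕ} {θ : Fin n → ℝ} {z : ℕ → Fin (n + 1) → ℤ}
    (hz : IsBestApprox θ z) (hθ : LinearIndependent ℚ (Fin.cons 1 θ : Fin (n + 1) → ℝ))
    {T : ℕ} (hT : 1 ≤ T) : linForm θ (intVec (z T)) ≠ 0 := by
  refine linForm_intVec_ne_zero hθ fun h0 => ?_
  obtain ⟨i, hi⟩ := (hz T hT).1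
  exact hi (by simp [h0])

lemma IsBestApprox.antitone {n : ℕ} {θ : Fin n → ℝ} {z : ℕ → Fin (n + 1) → ℤ}
    (hz : IsBestApprox θ z) {S T : ℕ} (hS : 1 ≤ S) (hST : S ≤ T) :
    |linForm θ (intVec (z T))| ≤ |linForm θ (intVec (z S))| :=
  (hz T (hS.trans hST)).2.2 (z S) (hz S hS).1 fun i =>
    ((hz S hS).2.1 i).trans (by exact_mod_cast hST)

lemma IsBestApprox.exists_approxSeq {n : ℕ} {θ : Fin n → ℝ} {z : ℕ → Fin (n + 1) → ℤ}
    (hz : IsBestApprox θ z) (hθ : LinearIndependent ℚ (Fin.cons 1 θ : Fin (n + 1) → ℝ))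
    {α β : ℝ} (hα : (α : EReal) < uniformLinExponent θ)
    (hβ : regularLinExponent θ < (β : EReal)) :
    ∃ K T₀, ApproxSeq (linForm θ) z α β K T₀ := by
  -- The room between α and α' pays for replacing T by T + 1 in the upper bound on |L(z_T)|. With T
  -- + 1, the bound at e can be read in terms of the next index e + 1.
  obtain ⟨α', hαα', hα'⟩ := EReal.lt_iff_exists_real_btwn.1 hα
  have hαα'' : α < α' := by exact_mod_cast hαα'
  have e1 := tendsto_natCast_atTop_atTop.eventually (eventually_linSolvable hα')
  have e2 := tendsto_natCast_atTop_atTop.eventually (eventually_not_linSolvable hβ)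
  have hlog : Filter.Tendsto (fun k : ℕ => Real.log k) Filter.atTop Filter.atTop :=
    Real.tendsto_log_atTop.comp tendsto_natCast_atTop_atTop
  have e3 := (hlog.const_mul_atTop (sub_pos.2 hαα'')).eventually_ge_atTop (|α| * Real.log 2)
  obtain ⟨T₀, hT₀⟩ := Filter.eventually_atTop.1
    (e1.and (e2.and (e3.and (Filter.eventually_ge_atTop 1))))
  have hone : ∀ T, T₀ ≤ T → 1 ≤ T := fun T hT => (hT₀ T hT).2.2.2
  refine ⟨|linForm θ (intVec (z 1))| + ∑ i, |θ i| + 1, T₀, hone T₀ le_rfl,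
    fun T hT => hz.ne_zero hθ (hone T hT), fun T hT => ?_,
    fun S T hS hST => hz.antitone (hone S hS) hST, fun T hT => ?_, fun T hT => ?_⟩
  · have hT1 : (1 : ℝ) ≤ T := by exact_mod_cast hone T hT
    have hA := abs_nonneg (linForm θ (intVec (z 1)))
    have hsum : 0 ≤ ∑ i, |θ i| := Finset.sum_nonneg fun i _ => abs_nonneg _
    rw [pi_norm_le_iff_of_nonneg (by positivity)]
    intro j
    rw [Real.norm_eq_abs]
    refine Fin.cases ?_ (fun i => ?_) j
    · have h1 := abs_zero_coord_le θ (hz T (hone T hT)).2.1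
      have h2 := hz.antitone le_rfl (hone T hT)
      simp only [intVec] at h1 h2 ⊢
      nlinarith
    · have h1 := (hz T (hone T hT)).2.1 i
      simp only [intVec]
      nlinarith
  · obtain ⟨x₀, x, hx, ⟨i, hi⟩, hxT⟩ := (hT₀ T hT).1
    have hT0 : (0 : ℝ) < T := by exact_mod_cast hone T hT
    have h1 := (hz T (hone T hT)).2.2 (Fin.cons x₀ x)
      ⟨i, by rintro h0; simp at h0; simp [h0] at hi⟩ (fun i => by simpa using hxT i)
    have h2 : linForm θ (intVec (Fin.cons x₀ x : Fin (n + 1) → ℤ)) =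
        x₀ + ∑ i, θ i * (x i : ℝ) := by simp [linForm_apply, intVec]
    rw [h2] at h1
    have h3 := Real.log_le_log (abs_pos.2 (hz.ne_zero hθ (hone T hT))) (h1.trans hx)
    rw [Real.log_rpow hT0] at h3
    have h4 : Real.log ((T : ℝ) + 1) ≤ Real.log T + Real.log 2 := by
      rw [← Real.log_mul hT0.ne' (by norm_num)]
      have hT1 : (1 : ℝ) ≤ T := by exact_mod_cast hone T hT
      exact Real.log_le_log (by positivity) (by linarith)
    have h5 : Real.log T ≤ Real.log ((T : ℝ) + 1) := Real.log_le_log hT0 (by linarith)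
    have h6 := (hT₀ T hT).2.2.1
    have h7 : α * (Real.log ((T : ℝ) + 1) - Real.log T) ≤ |α| * Real.log 2 :=
      mul_le_mul (le_abs_self α) (by linarith) (by linarith) (abs_nonneg α)
    linarith
  · by_contra! hcon
    have hT0 : (0 : ℝ) < T := by exact_mod_cast hone T hT
    refine (hT₀ T hT).2.1 ⟨z T 0, fun i => z T i.succ, ?_, ?_, (hz T (hone T hT)).2.1⟩
    · have h2 : (z T 0 : ℝ) + ∑ i, θ i * (z T (Fin.succ i) : ℝ) = linForm θ (intVec (z T)) := by
        simp [linForm_apply, intVec]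
      rw [h2, ← Real.log_le_log_iff (abs_pos.2 (hz.ne_zero hθ (hone T hT))) (by positivity),
        Real.log_rpow hT0]
      linarith
    · obtain ⟨i, hi⟩ := (hz T (hone T hT)).1
      exact ⟨i, by simpa using hi⟩

/-! ### The bound for the regular exponent λ. -/

section Regular

variable {n : ℕ} {θ : Fin n → ℝ} {z : ℕ → Fin (n + 1) → ℤ} {α β K : ℝ} {T₀ : ℕ}

lemma ApproxSeq.log_ge_of_half_le {L : (Fin (n + 1) → ℝ) →ₗ[ℝ] ℝ} (h : ApproxSeq L z α β K T₀)
    {e : ℕ} (he : T₀ ≤ e) {X : ℝ} (hX : 0 < X) (hXe : 1 / 2 ≤ X * |L (intVec (z e))|) :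
    α * Real.log (e + 1 : ℕ) - Real.log 2 ≤ Real.log X := by
  have h1 := Real.log_le_log (by norm_num) hXe
  rw [Real.log_mul hX.ne' (abs_ne_zero.2 (h.ne_zero e he)), one_div, Real.log_inv] at h1
  have h2 := h.upper e he
  push_cast
  linarith

lemma ApproxSeq.log_mul_le (hn : 1 ≤ n) (h : ApproxSeq (linForm θ) z α β K T₀)
    {q : ℕ} (hq : T₀ ≤ q) {X t γ : ℝ} (hX : 0 < X) (ht : 0 < t)
    (hXq : X * |linForm θ (intVec (z q))| ≤ n * q * t ^ (-γ)) :
    Real.log X + γ * Real.log t ≤ Real.log n + (1 + β) * Real.log q := by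
  have hn0 : (0 : ℝ) < n := by exact_mod_cast hn
  have hq0 : (0 : ℝ) < q := by exact_mod_cast h.one_le.trans hq
  have hL := abs_pos.2 (h.ne_zero q hq)
  have h1 := Real.log_le_log (by positivity) hXq
  rw [Real.log_mul hX.ne' hL.ne', Real.log_mul (by positivity) (by positivity),
    Real.log_mul hn0.ne' hq0.ne', Real.log_rpow ht] at h1
  have h2 := h.lower q hq
  linarith

lemma mul_rpow_lt_half (hn : 1 ≤ n) {q : ℕ} (hq : 1 ≤ q) {t γ : ℝ} (ht : 0 < t)
    (h : Real.log n + Real.log q + Real.log 2 < γ * Real.log t) :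
    n * q * t ^ (-γ) < 1 / 2 := by
  have hn0 : (0 : ℝ) < n := by exact_mod_cast hn
  have hq0 : (0 : ℝ) < q := by exact_mod_cast hq
  rw [← Real.log_lt_log_iff (by positivity) (by norm_num),
    Real.log_mul (by positivity) (by positivity), Real.log_mul hn0.ne' hq0.ne', Real.log_rpow ht,
    one_div, Real.log_inv]
  linarith

lemma ApproxSeq.tendsto_neg_log_abs {m : ℕ} {L : (Fin m → ℝ) →ₗ[ℝ] ℝ} {z : ℕ → Fin m → ℤ}
    (h : ApproxSeq L z α β K T₀) (hα : 0 < α) :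
    Filter.Tendsto (fun T : ℕ => -Real.log |L (intVec (z T))|) Filter.atTop Filter.atTop := by
  have h1 : Filter.Tendsto (fun k : ℕ => α * Real.log ((k : ℝ) + 1)) Filter.atTop Filter.atTop :=
    (Real.tendsto_log_atTop.comp
      (Filter.tendsto_atTop_add_const_right _ _ tendsto_natCast_atTop_atTop)).const_mul_atTop hα
  refine Filter.tendsto_atTop_mono' _ ?_ h1
  filter_upwards [Filter.eventually_ge_atTop T₀] with T hT
  exact h.upper T hT

/-- Let T be the first index, beyond a fixed P, with |x₀L(z_T)| < 1/2. Failure at T - 1 gives |x₀| ≥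
T^α/2, hence t ≥ T^α/2. If γ exceeded the bound, the pairing with z_T would vanish, so |x₀| t^γ ≤ n
T^(1+β), forcing (1 + γ)α ≤ 1 + β up to constants. -/
theorem IsBestApprox.simExponent_le (hn : 1 ≤ n) (hz : IsBestApprox θ z)
    (h : ApproxSeq (linForm θ) z α β K T₀) (hα : 0 < α) (hαβ : α ≤ β) {γ : ℝ}
    (hγ : ∃ᶠ t : ℝ in Filter.atTop, SimSolvable θ γ t) : γ ≤ (β - α + 1) / α := by
  by_contra! hcon
  have hγα : β - α + 1 < γ * α := (div_lt_iff₀ hα).1 hcon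
  have hγ0 : 0 < γ := lt_of_le_of_lt (by apply div_nonneg <;> linarith) hcon
  set c := γ * α - (β - α + 1) with hc
  have hc0 : 0 < c := by linarith
  have hlog : Filter.Tendsto (fun k : ℕ => Real.log k) Filter.atTop Filter.atTop :=
    Real.tendsto_log_atTop.comp tendsto_natCast_atTop_atTop
  obtain ⟨P, hPc, hPT⟩ := (((hlog.const_mul_atTop hc0).eventually_gt_atTop
    (Real.log n + (1 + γ) * Real.log 2)).and (Filter.eventually_ge_atTop T₀)).exists
  have hP1 : 1 ≤ P := h.one_le.trans hPT
  have e1 := eventually_pairing_ne_zero (h.ne_zero P hPT) hγ0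
  have e2 := (Real.tendsto_log_atTop.const_mul_atTop hγ0).eventually_gt_atTop
    (Real.log n + Real.log P + Real.log 2)
  obtain ⟨t, ⟨x₀, x, hx, hx0, hxt⟩, hne, htP, ht1⟩ :=
    (hγ.and_eventually (e1.and (e2.and (Filter.eventually_ge_atTop 1)))).exists
  have ht0 : 0 < t := by linarith
  set X := |(x₀ : ℝ)| with hX
  have hexT : ∃ T, P ≤ T ∧ X * |linForm θ (intVec (z T))| < 1 / 2 := by
    have e3 := (h.tendsto_neg_log_abs hα).eventually_gt_atTop (Real.log X + Real.log 2)
    obtain ⟨T, hT, hTP⟩ := (e3.and (Filter.eventually_ge_atTop P)).exists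
    refine ⟨T, hTP, ?_⟩
    have hL := abs_pos.2 (h.ne_zero T (hPT.trans hTP))
    rw [← Real.log_lt_log_iff (by positivity) (by norm_num), Real.log_mul hx0.ne' hL.ne',
      one_div, Real.log_inv]
    linarith
  classical
  obtain ⟨hTP, hTX⟩ := Nat.find_spec hexT
  have hTmin : ∀ e, e < Nat.find hexT → ¬ (P ≤ e ∧ X * |linForm θ (intVec (z e))| < 1 / 2) :=
    fun e he => Nat.find_min hexT he
  set T := Nat.find hexT with hT
  -- At T = P the pairing with z_P would vanish, which is excluded for large t. Hence T - 1 ≥ P and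
  -- the failure at T - 1 is available.
  have hPT' : P < T := by
    refine lt_of_le_of_ne hTP fun heq => ?_
    rw [← heq] at hTX
    refine hne x₀ x hx0 hx (pairing_eq_zero hx (Nat.cast_nonneg P) (hz P hP1).2.1 ?_)
    have := mul_rpow_lt_half hn hP1 ht0 htP
    linarith
  have hpre : 1 / 2 ≤ X * |linForm θ (intVec (z (T - 1)))| := by
    by_contra! hlt
    exact hTmin (T - 1) (by omega) ⟨by omega, hlt⟩
  have hD := h.log_ge_of_half_le (by omega) hx0 hpre
  rw [Nat.sub_add_cancel (by omega)] at hD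
  have hDt : Real.log X ≤ Real.log t := Real.log_le_log hx0 hxt
  have hlogT : Real.log P ≤ Real.log T :=
    Real.log_le_log (by exact_mod_cast hP1) (by exact_mod_cast hTP)
  have hlogT0 : 0 ≤ Real.log T := Real.log_natCast_nonneg T
  have hcT : c * Real.log P ≤ c * Real.log T := by gcongr
  have hl2 := Real.log_pos (show (1 : ℝ) < 2 by norm_num)
  have hM : γ * (α * Real.log T - Real.log 2) ≤ γ * Real.log X := by gcongr
  have hM' : γ * Real.log X ≤ γ * Real.log t := by gcongr
  have hsmall : n * T * t ^ (-γ) < 1 / 2 := by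
    refine mul_rpow_lt_half hn (by omega) ht0 ?_
    nlinarith
  have hzero := pairing_eq_zero hx (Nat.cast_nonneg T) (hz T (by omega)).2.1 (by linarith)
  have hfin := h.log_mul_le hn (by omega) hx0 ht0
    (abs_mul_linForm_le_of_pairing_eq_zero hx (Nat.cast_nonneg T) (hz T (by omega)).2.1 hzero)
  nlinarith

end Regular

/-! ### The bound for the uniform exponent λ̂. -/

section Uniform

variable {n : ℕ} {θ : Fin n → ℝ} {z : ℕ → Fin (n + 1) → ℤ} {α β K : ℝ} {T₀ : ℕ}

/-- One approximation annihilates all z_j from q up to p^R, R = r^(n-1), but not z_{q-1}. The upper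
end comes from γα > R. The inequality p ≤ q^r comes from |x₀| ≥ q^α/2 and the vanishing at q,
combined with β - α + 1 ≤ r^n. -/
lemma IsBestApprox.exists_pairing_step (hn : 1 ≤ n) (hz : IsBestApprox θ z)
    (h : ApproxSeq (linForm θ) z α β K T₀) (hα : 0 < α) (hαβ : α ≤ β) {γ : ℝ}
    (hγ : ∀ᶠ t : ℝ in Filter.atTop, SimSolvable θ γ t) (hγ0 : 0 < γ)
    (hγα : (β / α) ^ (n - 1) < γ * α) (P : ℕ) :
    ∃ P', ∀ p, P' ≤ p → ∃ (q : ℕ) (x₀ : ℤ) (x : Fin n → ℤ), P < q ∧ q < p ∧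
      Real.log p ≤ β / α * Real.log q ∧
      (∀ j, q ≤ j → Real.log j ≤ (β / α) ^ (n - 1) * Real.log p →
        pairing x₀ x (intVec (z j)) = 0) ∧
      pairing x₀ x (intVec (z (q - 1))) ≠ 0 := by
  set r := β / α with hr
  have hr1 : 1 ≤ r := (one_le_div hα).2 hαβ
  have hr0 : 0 < r := by linarith
  set R := r ^ (n - 1) with hR
  have hR1 : 1 ≤ R := one_le_pow₀ hr1
  have hRr : r ^ n = R * r := by rw [hR, ← pow_succ, Nat.sub_add_cancel hn]
  have hMM : β - α + 1 ≤ R * r := hRr ▸ h.sub_add_one_le_pow hn hα hαβ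
  set Q := max P T₀ with hQ
  have hQT : T₀ ≤ Q := le_max_right _ _
  have hPQ : P ≤ Q := le_max_left _ _
  have hT1 := h.one_le
  set c := γ * α - R with hc
  have hc0 : 0 < c := by linarith
  have hl2 := Real.log_pos (show (1 : ℝ) < 2 by norm_num)
  have hl4 := Real.log_pos (show (1 : ℝ) < 4 by norm_num)
  have hlog : Filter.Tendsto (fun k : ℕ => Real.log k) Filter.atTop Filter.atTop :=
    Real.tendsto_log_atTop.comp tendsto_natCast_atTop_atTop
  -- This is t = 1/(4|L(z_{p-1})|), so that |x₀L(z_j)| ≤ 1/4 for all j ≥ p - 1, while t ≥ p^α/4.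
  let t : ℕ → ℝ := fun p => Real.exp (-Real.log |linForm θ (intVec (z (p - 1)))| - Real.log 4)
  have ht : Filter.Tendsto t Filter.atTop Filter.atTop :=
    Real.tendsto_exp_atTop.comp (Filter.tendsto_atTop_add_const_right _ _
      ((h.tendsto_neg_log_abs hα).comp (Filter.tendsto_sub_atTop_nat 1)))
  have e1 := ht.eventually (hγ.and (eventually_pairing_ne_zero (h.ne_zero Q hQT) hγ0))
  have e2 := (hlog.const_mul_atTop hc0).eventually_gt_atTop
    (Real.log n + Real.log 2 + γ * Real.log 4)
  obtain ⟨P', hP'⟩ := Filter.eventually_atTop.1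
    (e1.and (e2.and (Filter.eventually_ge_atTop (Q + 2))))
  refine ⟨P', fun p hp => ?_⟩
  obtain ⟨⟨⟨x₀, x, hx, hx0, hxt⟩, hne⟩, hcp, hpQ⟩ := hP' p hp
  have ht0 : 0 < t p := Real.exp_pos _
  have hlp : 0 ≤ Real.log p := Real.log_natCast_nonneg p
  have hlogt : α * Real.log p - Real.log 4 ≤ Real.log (t p) := by
    have h1 := h.upper (p - 1) (by omega)
    have h2 : ((p - 1 : ℕ) : ℝ) + 1 = p := by
      rw [Nat.cast_sub (by omega)]; simp
    rw [h2] at h1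
    simp only [t, Real.log_exp]
    linarith
  have hγt : γ * (α * Real.log p - Real.log 4) ≤ γ * Real.log (t p) := by gcongr
  have htL : t p * |linForm θ (intVec (z (p - 1)))| = 1 / 4 := by
    have hL := abs_pos.2 (h.ne_zero (p - 1) (by omega))
    simp only [t]
    rw [Real.exp_sub, Real.exp_neg, Real.exp_log hL, Real.exp_log (by norm_num)]
    field_simp
  have hsmall : ∀ j : ℕ, 1 ≤ j → Real.log j ≤ R * Real.log p → n * j * t p ^ (-γ) < 1 / 2 := by
    intro j hj hjp
    refine mul_rpow_lt_half hn hj ht0 ?_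
    nlinarith
  have hkill : ∀ j : ℕ, p - 1 ≤ j → Real.log j ≤ R * Real.log p →
      pairing x₀ x (intVec (z j)) = 0 := by
    intro j hj hjp
    refine pairing_eq_zero hx (Nat.cast_nonneg j) (hz j (by omega)).2.1 ?_
    have h1 := hsmall j (by omega) hjp
    have h2 : |(x₀ : ℝ)| * |linForm θ (intVec (z j))| ≤ 1 / 4 := by
      rw [← htL]
      exact mul_le_mul hxt (h.antitone _ _ (by omega) hj) (abs_nonneg _) ht0.le
    linarith
  obtain ⟨e, heQ, hep, hene, hemax⟩ := exists_greatest_lt_not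
    (P := fun j => pairing x₀ x (intVec (z j)) = 0) (a := Q) (b := p - 1)
    ⟨Q, le_rfl, by omega, hne x₀ x hx0 hx⟩
  have hlogle : ∀ j : ℕ, 1 ≤ j → j ≤ p → Real.log j ≤ R * Real.log p := by
    intro j hj hjp
    have : Real.log j ≤ Real.log p :=
      Real.log_le_log (by exact_mod_cast hj) (by exact_mod_cast hjp)
    nlinarith
  have hker : ∀ j : ℕ, e + 1 ≤ j → Real.log j ≤ R * Real.log p →
      pairing x₀ x (intVec (z j)) = 0 := by
    intro j hj hjp
    rcases lt_or_ge j (p - 1) with h1 | h1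
    · exact hemax j (by omega) h1
    · exact hkill j h1 hjp
  refine ⟨e + 1, x₀, x, by omega, by omega, ?_, hker, by simpa using hene⟩
  have hehalf : 1 / 2 ≤ |(x₀ : ℝ)| * |linForm θ (intVec (z e))| := by
    have h1 := one_le_of_pairing_ne_zero hx (Nat.cast_nonneg e) (hz e (by omega)).2.1 hene
    have h2 := hsmall e (by omega) (hlogle e (by omega) (by omega))
    linarith
  have hD := h.log_ge_of_half_le (by omega) hx0 hehalf
  have hfin := h.log_mul_le (q := e + 1) hn (by omega) hx0 ht0
    (abs_mul_linForm_le_of_pairing_eq_zero hx (Nat.cast_nonneg _) (hz (e + 1) (by omega)).2.1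
      (hker (e + 1) le_rfl (hlogle _ (by omega) (by omega))))
  have hle : 0 ≤ Real.log (e + 1 : ℕ) := Real.log_natCast_nonneg _
  have h1 : (β - α + 1) * Real.log (e + 1 : ℕ) ≤ R * r * Real.log (e + 1 : ℕ) := by gcongr
  have h2 : R * Real.log p < R * (r * Real.log (e + 1 : ℕ)) := by nlinarith
  exact (lt_of_mul_lt_mul_left h2 (by linarith)).le

/-- Take p where |L(z_p)| drops strictly. If z_p were a multiple of z_{p-1}, the factor would be at
most 1 in absolute value, so z_p would already be admissible at p - 1, against minimality. -/
lemma IsBestApprox.exists_linearIndependent_pair (hz : IsBestApprox θ z)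
    (h : ApproxSeq (linForm θ) z α β K T₀) (hα : 0 < α) (P : ℕ) :
    ∃ p, P < p ∧ LinearIndependent ℝ ![intVec (z (p - 1)), intVec (z p)] := by
  have hdrop : ∃ p, max P T₀ < p ∧
      |linForm θ (intVec (z p))| < |linForm θ (intVec (z (p - 1)))| := by
    by_contra! hcon
    have hconst : ∀ k, |linForm θ (intVec (z (max P T₀)))| ≤
        |linForm θ (intVec (z (max P T₀ + k)))| := by
      intro k
      induction k with
      | zero => exact le_rfl
      | succ k ih => exact ih.trans (hcon (max P T₀ + (k + 1)) (by omega))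
    obtain ⟨T, hT, hTP⟩ := (((h.tendsto_neg_log_abs hα).eventually_gt_atTop
      (-Real.log |linForm θ (intVec (z (max P T₀)))|)).and
      (Filter.eventually_ge_atTop (max P T₀))).exists
    obtain ⟨k, rfl⟩ := Nat.exists_eq_add_of_le hTP
    have := Real.log_le_log (abs_pos.2 (h.ne_zero _ (le_max_right P T₀))) (hconst k)
    linarith
  obtain ⟨p, hp, hlt⟩ := hdrop
  have hT1 := h.one_le
  have hPm : P ≤ max P T₀ := le_max_left _ _
  have hTm : T₀ ≤ max P T₀ := le_max_right _ _
  refine ⟨p, by omega, LinearIndependent.pair_iff.2 fun a b hab => ?_⟩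
  have hLne := h.ne_zero (p - 1) (by omega)
  have hL : a * linForm θ (intVec (z (p - 1))) + b * linForm θ (intVec (z p)) = 0 := by
    simpa using congrArg (linForm θ) hab
  have hb : b = 0 := by
    by_contra hb
    have hc : ∀ u v : ℝ, a * u + b * v = 0 → |v| = |a / b| * |u| := fun u v huv => by
      rw [← abs_mul, ← abs_neg]
      congr 1
      field_simp
      linarith
    have h1 := hc _ _ hL
    have h2 : |a / b| ≤ 1 := by
      by_contra! h3
      nlinarith [abs_pos.2 hLne]
    refine absurd ((hz (p - 1) (by omega)).2.2 (z p) (hz p (by omega)).1 fun i => ?_) (not_le.2 hlt)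
    have h3 := hc (z (p - 1) i.succ) (z p i.succ) (by
      simpa [intVec] using congrFun hab i.succ)
    rw [h3]
    refine (mul_le_of_le_one_left (abs_nonneg _) h2).trans ((hz (p - 1) (by omega)).2.1 i)
  subst hb
  simpa [hLne] using hL

theorem IsBestApprox.uniformSimExponent_le (hn : 1 ≤ n) (hz : IsBestApprox θ z)
    (h : ApproxSeq (linForm θ) z α β K T₀) (hα : 0 < α) (hαβ : α ≤ β) {γ : ℝ}
    (hγ : ∀ᶠ t : ℝ in Filter.atTop, SimSolvable θ γ t) : γ * α ≤ (β / α) ^ (n - 1) := by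
  by_contra! hγα
  set r := β / α with hr
  have hr1 : 1 ≤ r := (one_le_div hα).2 hαβ
  have hγ0 : 0 < γ := by
    have : 0 < γ * α := lt_of_le_of_lt (by positivity) hγα
    exact pos_of_mul_pos_left this hα.le
  have hstep := hz.exists_pairing_step hn h hα hαβ hγ hγ0 hγα
  let F : ℕ → ℕ → Submodule ℝ (Fin (n + 1) → ℝ) := fun a b =>
    Submodule.span ℝ ((fun T => intVec (z T)) '' Set.Icc a b)
  have hFker : ∀ {q p a : ℕ} {x₀ : ℤ} {x : Fin n → ℤ}, q ≤ a → 1 ≤ a →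
      (∀ j, q ≤ j → Real.log j ≤ Real.log p → pairing x₀ x (intVec (z j)) = 0) →
      F a p ≤ LinearMap.ker (pairing x₀ x) := by
    intro q p a x₀ x hqa ha hk
    refine Submodule.span_le.2 ?_
    rintro _ ⟨j, hj, rfl⟩
    exact hk j (hqa.trans hj.1) (Real.log_le_log (by exact_mod_cast ha.trans hj.1)
      (by exact_mod_cast hj.2))
  -- Each step extends the block to the left, costs one factor r in the exponent and gains one
  -- dimension. The vanishing range p^R allows exactly the n - 1 extensions needed to fill the
  -- space.
  have hchain : ∀ k, k ≤ n - 1 → ∀ P, ∃ p q, P < q ∧ q ≤ p ∧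
      k + 2 ≤ Module.finrank ℝ (F (q - 1) p) ∧ Real.log p ≤ r ^ k * Real.log q := by
    intro k
    induction k with
    | zero =>
      intro _ P
      obtain ⟨p, hp, hli⟩ := hz.exists_linearIndependent_pair h hα P
      refine ⟨p, p, hp, le_rfl, ?_, by simp⟩
      have h1 := finrank_span_eq_card hli
      rw [Fintype.card_fin] at h1
      rw [zero_add]
      refine h1.ge.trans (Submodule.finrank_mono (Submodule.span_mono ?_))
      rintro _ ⟨i, rfl⟩
      fin_cases i
      · exact ⟨p - 1, ⟨le_rfl, by omega⟩, rfl⟩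
      · exact ⟨p, ⟨by omega, le_rfl⟩, rfl⟩
    | succ k ih =>
      intro hk P
      obtain ⟨P', hP'⟩ := hstep P
      obtain ⟨p, q, hq, hqp, hrank, hlog⟩ := ih (by omega) (max P P')
      have hPm : P ≤ max P P' := le_max_left _ _
      have hPm' : P' ≤ max P P' := le_max_right _ _
      obtain ⟨q', x₀, x, hPq', hq'q, hlog', hkill, hne⟩ := hP' q (by omega)
      have hlq : 0 ≤ Real.log q := Real.log_natCast_nonneg q
      have hpq : Real.log p ≤ r ^ (n - 1) * Real.log q := by
        refine hlog.trans ?_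
        have : r ^ k ≤ r ^ (n - 1) := pow_le_pow_right₀ hr1 (by omega)
        gcongr
      refine ⟨p, q', hPq', by omega, ?_, ?_⟩
      -- The pairing kills the old block, which begins at q - 1 ≥ q', but not the new vector
      -- z_{q'-1}.
      · have hlt : F (q - 1) p < F (q' - 1) p := by
          refine lt_of_le_of_ne (Submodule.span_mono (Set.image_mono
            (Set.Icc_subset_Icc_left (by omega)))) fun heq => hne ?_
          have h1 : intVec (z (q' - 1)) ∈ F (q - 1) p := by
            rw [heq]
            exact Submodule.subset_span ⟨q' - 1, ⟨le_rfl, by omega⟩, rfl⟩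
          exact hFker (q := q') (by omega) (by omega)
            (fun j hj hjp => hkill j hj (hjp.trans hpq)) h1
        have := Submodule.finrank_lt_finrank_of_lt hlt
        omega
      · refine hlog.trans ?_
        rw [pow_succ, mul_assoc]
        gcongr
  obtain ⟨P', hP'⟩ := hstep 1
  obtain ⟨p, q, hq, hqp, hrank, hlog⟩ := hchain (n - 1) le_rfl P'
  -- One more approximation annihilates a block that already spans the whole space, although its
  -- pairing with z_{q'-1} is nonzero.
  obtain ⟨q', x₀, x, hPq', hq'q, hlog', hkill, hne⟩ := hP' q hq.le
  have htop : F (q - 1) p = ⊤ := by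
    refine Submodule.eq_top_of_finrank_eq (le_antisymm (Submodule.finrank_le _) ?_)
    rw [Module.finrank_fin_fun]
    omega
  have hk := hFker (q := q') (a := q - 1) (p := p) (x₀ := x₀) (x := x) (by omega) (by omega)
    (fun j hj hjp => hkill j hj (hjp.trans hlog))
  rw [htop] at hk
  exact hne (hk (Submodule.mem_top (x := intVec (z (q' - 1)))))

end Uniform

/-! ### Passage to the limit α → ω̂, β → ω. -/

lemma le_div_of_forall_lt {w o γ : ℝ} {a b : ℕ} (hw : 0 < w)
    (h : ∀ α β : ℝ, 0 < α → α < w → o < β → γ ≤ β ^ a / α ^ b) : γ ≤ o ^ a / w ^ b := by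
  have hlim : Filter.Tendsto (fun ε : ℝ => (o + ε) ^ a / (w - ε) ^ b) (nhdsWithin 0 (Set.Ioi 0))
      (nhds ((o + 0) ^ a / (w - 0) ^ b)) := by
    refine tendsto_nhdsWithin_of_tendsto_nhds (ContinuousAt.tendsto ?_)
    have : (w - 0) ^ b ≠ 0 := by rw [sub_zero]; positivity
    exact ContinuousAt.div (by fun_prop) (by fun_prop) this
  rw [add_zero, sub_zero] at hlim
  refine ge_of_tendsto hlim ?_
  filter_upwards [Ioo_mem_nhdsGT hw] with ε hε
  exact h _ _ (by linarith [hε.2]) (by linarith [hε.1]) (by linarith [hε.1])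

lemma EReal.top_pow_div_coe {w : ℝ} (hw : 0 < w) {a : ℕ} (ha : a ≠ 0) (b : ℕ) :
    (⊤ : EReal) ^ a / (w : EReal) ^ b = ⊤ := by
  have h1 : (⊤ : EReal) ^ a = ⊤ := by
    obtain ⟨k, rfl⟩ := Nat.exists_eq_succ_of_ne_zero ha
    clear ha
    induction k with
    | zero => simp
    | succ k ih => rw [pow_succ, ih, EReal.top_mul_top]
  rw [h1, ← EReal.coe_pow]
  exact EReal.top_div_of_pos_ne_top (by exact_mod_cast pow_pos hw b) (EReal.coe_ne_top _)

theorem proposition3 (n : ℕ) (hn : 2 ≤ n) (θ : Fin n → ℝ)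
    (hθ : LinearIndependent ℚ (Fin.cons 1 θ : Fin (n + 1) → ℝ))
    (hfin : uniformLinExponent θ ≠ ⊤) :
    uniformSimExponent θ ≤ regularLinExponent θ ^ (n - 1) / uniformLinExponent θ ^ n ∧
      regularSimExponent θ ≤ regularLinExponent θ ^ n / uniformLinExponent θ ^ (n + 1) := by
  have hn1 : 1 ≤ n := by omega
  have hone := one_le_uniformLinExponent hn1 θ
  have hle := uniformLinExponent_le_regularLinExponent θ
  obtain ⟨w, hw⟩ : ∃ w : ℝ, uniformLinExponent θ = w := by
    refine ⟨(uniformLinExponent θ).toReal, (EReal.coe_toReal hfin fun hbot => ?_).symm⟩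
    rw [hbot] at hone
    exact absurd hone (by decide)
  rw [hw] at hone
  have hw1 : 1 ≤ w := by exact_mod_cast hone
  have hw0 : 0 < w := by linarith
  by_cases htop : regularLinExponent θ = ⊤
  -- Here n ≥ 2 is essential: the exponent n - 1 must be nonzero for ⊤ ^ (n - 1) to be ⊤.
  · rw [htop, hw, EReal.top_pow_div_coe hw0 (by omega), EReal.top_pow_div_coe hw0 (by omega)]
    exact ⟨le_top, le_top⟩
  obtain ⟨o, ho⟩ : ∃ o : ℝ, regularLinExponent θ = o := by
    refine ⟨(regularLinExponent θ).toReal, (EReal.coe_toReal htop fun hbot => ?_).symm⟩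
    rw [hbot, hw] at hle
    simp at hle
  have hwo : w ≤ o := by
    rw [hw, ho] at hle
    exact_mod_cast hle
  obtain ⟨z, hz⟩ := exists_isBestApprox hn1 θ
  have hseq : ∀ α β : ℝ, α < w → o < β → ∃ K T₀, ApproxSeq (linForm θ) z α β K T₀ :=
    fun α β hα hβ => hz.exists_approxSeq hθ (by rw [hw]; exact_mod_cast hα)
      (by rw [ho]; exact_mod_cast hβ)
  rw [hw, ho, ← EReal.coe_pow, ← EReal.coe_pow, ← EReal.coe_pow, ← EReal.coe_pow,
    ← EReal.coe_div, ← EReal.coe_div]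
  refine ⟨sSup_le ?_, sSup_le ?_⟩
  · rintro _ ⟨γ, hγ, rfl⟩
    refine EReal.coe_le_coe_iff.2 (le_div_of_forall_lt hw0 fun α β hα hαw hoβ => ?_)
    obtain ⟨K, T₀, h⟩ := hseq α β hαw hoβ
    have h1 := hz.uniformSimExponent_le hn1 h hα (by linarith) hγ
    rw [← le_div_iff₀ hα, div_pow, div_div, ← pow_succ, Nat.sub_add_cancel hn1] at h1
    exact h1
  · rintro _ ⟨γ, hγ, rfl⟩
    refine EReal.coe_le_coe_iff.2 (le_div_of_forall_lt hw0 fun α β hα hαw hoβ => ?_)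
    obtain ⟨K, T₀, h⟩ := hseq α β hαw hoβ
    refine (hz.simExponent_le hn1 h hα (by linarith) hγ).trans ?_
    rw [pow_succ, ← div_div, ← div_pow]
    exact div_le_div_of_nonneg_right (h.sub_add_one_le_pow hn1 hα (by linarith)) hα.le
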